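/- **Definitions.** For a $k\times\ell$ matrix $p$ of probabilities let $I(p)=\sum_{i,j}p(i,j)\log_2\frac{p(i,j)}{p(i,*)\,p(*,j)}$ (terms with $p(i,j)=0$ are $0$) and $I^\star(p)=I(p)/\log_2\min\{k,\ell\}$. *$\mathrm{MIC}^*$.* A $k\times\ell$ grid consists of a partition $P_1,\dots,P_k$ of the $y$-axis and a partition $Q_1,\dots,Q_\ell$ of the $x$-axis into nonempty intervals. For a pair $\Pi=(X,Y)$ of real random variables, $$\mathrm{MIC}^*(\Pi)=\sup_{k,\ell\ge 2}\ \sup_{G}\ I^\star(\Pi|_G),$$ where $G$ ranges over all $k\times\ell$ grids and $\Pi|_G$ is the matrix with entries $\Pr(X\in Q_j,\,Y\in P_i)$. *Subgrids.* Let $L=[x_0,x_1]\times[y_0,y_1]$ with $x_0<x_1$, $y_0<y_1$, and let $c>0$. A size-$m$ range equipartition of an interval divides it into $m$ consecutive intervals of equal length. For $k,\ell\ge2$ let the master grid $\Gamma_{k,\ell}$ consist of the range equipartitions of $[y_0,y_1]$ into $r$ rows and of $[x_0,x_1]$ into $s$ columns, where $(r,s)=(\lceil c\ell\rceil,\ell)$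 if $k\le\ell$ and $(r,s)=(k,\lceil ck\rceil)$ if $k>\ell$. Let $\mathcal R(L,c,k,\ell)$ be the set of all $k\times\ell$ grids obtained from $\Gamma_{k,\ell}$ by merging consecutive rows into $k$ nonempty blocks and consecutive columns into $\ell$ nonempty blocks (so the axis that already has the target size is left unchanged). *Truncated geometric distribution.* For $\epsilon>0$, $n\ge1$, $0\le f\le n$ and $\rho=e^{-\epsilon}$, $\mathrm{TruncGeom}(\epsilon,n,f)$ is the distribution on $\{0,\dots,n\}$ that gives mass $\rho^f/(1+\rho)$ to $0$, mass $\frac{1-\rho}{1+\rho}\rho^{|f-i|}$ to each $1\le i\le n-1$, and mass $\rho^{n-f}/(1+\rho)$ to $n$. *The mechanism.* For a dataset $D$ of $n\ge 1$ points in $L$ and $B\in\mathbb R$, the randomized statistic $\mathrm{MICr\text{-}Geom}(D,L,B,c,\epsilon)$ is computed as follows. For every $k,\ell\ge 2$ let $\widehat A=\widehat A^{(k,\ell)}$ be a random matrix of the size of $\Gamma_{k,\ell}$ with independent entries $\widehat A(i,j)\sim\mathrm{TruncGeom}(\epsilon/2,n,a(i,j))$, where $a(i,j)$ is the number of points of $D$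 in cell $(i,j)$ of $\Gamma_{k,\ell}$; the dependence between the matrices for different pairs $(k,\ell)$ may be arbitrary. Let $\widehat n$ be the sum of the entries of $\widehat A$ and $\widehat P=\widehat A/\widehat n$ (and $\widehat P=0$ if $\widehat n=0$). For $G\in\mathcal R(L,c,k,\ell)$ let $\widehat P_G$ be the $k\times\ell$ matrix obtained by summing the entries of $\widehat P$ over merged cells. The output is $$\max_{k,\ell\ge2,\ k\ell\le B}\ \max_{G\in\mathcal R(L,c,k,\ell)}I^\star(\widehat P_G),$$ a maximum over an empty set being $0$. **Theorem.** Let $L=[x_0,x_1]\times[y_0,y_1]$ with $x_0<x_1$ and $y_0<y_1$. For every finite $c>0$, every $\epsilon>0$, every $\alpha\in(0,0.5)$ and every $B:\mathbb N\to\mathbb R$ with $B(n)\to\infty$ and $B(n)=O(n^\alpha)$, $\mathrm{MICr\text{-}Geom}(\cdot,L,B,c,\epsilon)$ is a consistent estimator of $\mathrm{MIC}^*$: for every jointly distributed pair $\Pi=(X,Y)$ with values in $L$ almost surely, if $D_n$ consists of $n$ points drawn i.i.d. from $\Pi$, then $$\mathrm{MICr\text{-}Geom}(D_n,L,B(n),c,\epsilon)\longrightarrow\mathrm{MIC}^*(\Pi)\quad\text{in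 probability as }n\to\infty,$$ the probability being over both the sample and the noise of the mechanism. -/

import Mathlib

open Set Filter Topology MeasureTheory Asymptotics

noncomputable section

namespace MICr

/-! ### Discrete mutual information -/

/-- Mutual information (in bits) of a `k × ℓ` matrix of probabilities; terms with `p i j = 0`
contribute `0`. -/
def mutualInfo {k l : ℕ} (p : Fin k → Fin l → ℝ) : ℝ :=
  ∑ i, ∑ j, p i j * Real.logb 2 (p i j / ((∑ j', p i j') * (∑ i', p i' j)))

/-- Normalized mutual information `I / log₂ (min k ℓ)`. -/
def normMutualInfo {k l : ℕ} (p : Fin k → Fin l → ℝ) : ℝ :=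
  mutualInfo p / Real.logb 2 ((min k l : ℕ) : ℝ)

/-! ### Grids on the plane and `MIC*` -/

/-- A partition of the real line into `k` nonempty intervals (of any kind). -/
structure IntervalPartition (k : ℕ) where
  part : Fin k → Set ℝ
  ordConnected : ∀ i, (part i).OrdConnected
  nonempty : ∀ i, (part i).Nonempty
  disjoint : Pairwise fun i j => Disjoint (part i) (part j)
  cover : ⋃ i, part i = univ

/-- A `k × ℓ` grid: `k` rows partition the `y`-axis, `ℓ` columns partition the `x`-axis. -/
structure Grid (k l : ℕ) where
  rows : IntervalPartition k
  cols : IntervalPartition l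

/-- The matrix of cell probabilities `P(X ∈ Q_j, Y ∈ P_i)` of the law `μ` of `(X, Y)`. -/
def gridProb (μ : Measure (ℝ × ℝ)) {k l : ℕ} (G : Grid k l) : Fin k → Fin l → ℝ :=
  fun i j => μ.real (G.cols.part j ×ˢ G.rows.part i)

/-- The `(k, ℓ)` entry of the characteristic matrix of `μ`. -/
def charMatrix (μ : Measure (ℝ × ℝ)) (k l : ℕ) : ℝ :=
  ⨆ G : Grid k l, normMutualInfo (gridProb μ G)

/-- `MIC*`: the supremum of the characteristic matrix over all sizes `k, ℓ ≥ 2`. -/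
def micStar (μ : Measure (ℝ × ℝ)) : ℝ :=
  ⨆ s : {s : ℕ × ℕ // 2 ≤ s.1 ∧ 2 ≤ s.2}, charMatrix μ s.1.1 s.1.2

/-! ### Range equipartitions, master grids and subgrids -/

/-- A range `L = [x₀, x₁] × [y₀, y₁]`. -/
structure Range where
  x₀ : ℝ
  x₁ : ℝ
  y₀ : ℝ
  y₁ : ℝ
  x_lt : x₀ < x₁
  y_lt : y₀ < y₁

/-- The rectangle underlying a range. -/
def Range.toSet (L : Range) : Set (ℝ × ℝ) := Icc L.x₀ L.x₁ ×ˢ Icc L.y₀ L.y₁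

/-- The parts of the size-`m` range equipartition of `[a, b]`: the half-open intervals
`[a + i (b - a) / m, a + (i + 1) (b - a) / m)`, the last one being closed. -/
def rangePart (a b : ℝ) (m : ℕ) (i : Fin m) : Set ℝ :=
  {x | a + i * ((b - a) / m) ≤ x ∧
    (x < a + (i + 1) * ((b - a) / m) ∨ ((i : ℕ) + 1 = m ∧ x = b))}

/-- Number of rows of the master grid for `(k, ℓ)`: `cℓ` (rounded up) if `k ≤ ℓ`, else `k`. -/
def masterRows (c : ℝ) (k l : ℕ) : ℕ := if k ≤ l then ⌈c * l⌉₊ else k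

/-- Number of columns of the master grid for `(k, ℓ)`: `ℓ` if `k ≤ ℓ`, else `ck` (rounded up). -/
def masterCols (c : ℝ) (k l : ℕ) : ℕ := if k ≤ l then l else ⌈c * k⌉₊

/-- The number of points of the dataset `D` in cell `(i, j)` of the `r × s` grid of range
equipartitions of `L`. -/
def countMatrix (L : Range) (r s : ℕ) {n : ℕ} (D : Fin n → ℝ × ℝ) : Fin r → Fin s → ℕ :=
  fun i j => Nat.card {m : Fin n //
    (D m).1 ∈ rangePart L.x₀ L.x₁ s j ∧ (D m).2 ∈ rangePart L.y₀ L.y₁ r i}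

/-- A size-`k` subpartition of an ordered size-`m` partition: consecutive parts are merged into
`k` nonempty blocks. The map sends each old part to the block that contains it. -/
def Subpartition (m k : ℕ) : Type := {g : Fin m → Fin k // Monotone g ∧ Function.Surjective g}

/-- The grids of size `k × ℓ` over which the `(k, ℓ)` entry is maximized: all `k × ℓ` subgrids of
the master grid. One axis of the master grid already has the target size, and there the only
subpartition is the trivial one; so this is the set of grids with range-equipartitioned columns
and rows from the size-`cℓ` range equipartition if `k ≤ ℓ`, and symmetrically if `k > ℓ`. -/
def SubGrid (c : ℝ) (k l : ℕ) : Type :=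
  Subpartition (masterRows c k l) k × Subpartition (masterCols c k l) l

open Classical in
/-- The matrix of a subgrid, generated from the matrix of the master grid by summing the entries
of the merged cells. -/
def mergeMatrix {c : ℝ} {k l : ℕ} (p : Fin (masterRows c k l) → Fin (masterCols c k l) → ℝ)
    (G : SubGrid c k l) : Fin k → Fin l → ℝ :=
  fun i j => ∑ a with G.1.1 a = i, ∑ b with G.2.1 b = j, p a b

/-! ### The truncated geometric distribution -/

/-- Probability of the outcome `i` under `TruncGeom(ε, n, f)`. -/
def truncGeomWeight (ε : ℝ) (n f i : ℕ) : ℝ :=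
  if i = 0 then Real.exp (-ε) ^ f / (1 + Real.exp (-ε))
  else if i < n then
    (1 - Real.exp (-ε)) / (1 + Real.exp (-ε)) * Real.exp (-ε) ^ ((f : ℤ) - i).natAbs
  else if i = n then Real.exp (-ε) ^ (n - f) / (1 + Real.exp (-ε))
  else 0

/-- The law `TruncGeom(ε, n, f)` on `{0, …, n}`, for `n ≥ 1` and `f ≤ n`. -/
def truncGeom (ε : ℝ) (n f : ℕ) : Measure ℕ :=
  ∑ i ∈ Finset.range (n + 1), ENNReal.ofReal (truncGeomWeight ε n f i) • Measure.dirac i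

/-! ### The mechanism `MICr-Geom` -/

/-- A noisy count matrix for every `(k, ℓ)`, each on the master grid for `(k, ℓ)`. -/
abbrev NoisyCounts (c : ℝ) : Type :=
  ∀ k l : ℕ, Fin (masterRows c k l) → Fin (masterCols c k l) → ℕ

/-- The law of the noisy count matrix for `(k, ℓ)`: the entries are independent, and the entry
`(i, j)` has law `TruncGeom(ε / 2, n, a(i, j))`. -/
def noisyCountLaw (L : Range) (c ε : ℝ) {n : ℕ} (D : Fin n → ℝ × ℝ) (k l : ℕ) :
    Measure (Fin (masterRows c k l) → Fin (masterCols c k l) → ℕ) :=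
  Measure.pi fun i => Measure.pi fun j =>
    truncGeom (ε / 2) n (countMatrix L (masterRows c k l) (masterCols c k l) D i j)

/-- The noisy count matrix divided by the sum of its entries. -/
def normalize {r s : ℕ} (A : Fin r → Fin s → ℕ) : Fin r → Fin s → ℝ :=
  fun i j => (A i j : ℝ) / ((∑ i', ∑ j', A i' j' : ℕ) : ℝ)

/-- The `(k, ℓ)` entry of the noisy range-equicharacteristic matrix. -/
def noisyEntry (c : ℝ) (k l : ℕ) (A : Fin (masterRows c k l) → Fin (masterCols c k l) → ℕ) : ℝ :=
  ⨆ G : SubGrid c k l, normMutualInfo (mergeMatrix (normalize A) G)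

/-- The output of `MICr-Geom` as a function of the noisy count matrices: the maximum of the
noisy range-equicharacteristic matrix over `k, ℓ ≥ 2` with `k ℓ ≤ B`. -/
def micrGeomOutput (B c : ℝ) (A : NoisyCounts c) : ℝ :=
  ⨆ s : {s : ℕ × ℕ // 2 ≤ s.1 ∧ 2 ≤ s.2 ∧ ((s.1 * s.2 : ℕ) : ℝ) ≤ B},
    noisyEntry c s.1.1 s.1.2 (A s.1.1 s.1.2)

/-- `ρ` is the law of the random output `MICr-Geom(D, L, B, c, ε)`. The noisy count matrix for each
`(k, ℓ)` has the prescribed law; the dependence between the matrices for different `(k, ℓ)` is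
left free, so that fresh noise for every `(k, ℓ)` and noise shared by all `(k, ℓ)` with the same
master grid are both covered. -/
def IsMICrGeom (L : Range) (B c ε : ℝ) {n : ℕ} (D : Fin n → ℝ × ℝ) (ρ : Measure ℝ) : Prop :=
  ∃ ν : Measure (NoisyCounts c),
    (∀ k l : ℕ, 2 ≤ k → 2 ≤ l → ν.map (fun A => A k l) = noisyCountLaw L c ε D k l) ∧
    ρ = ν.map (micrGeomOutput B c)

/-! ### Consistency -/

/-- A randomized estimator `T` (with `T n D` the law of its output on a dataset `D` of size `n`)
is a consistent estimator of `θ` on a class of distributions on the plane if, for every `μ` in the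
class, the output on `n` points drawn i.i.d. from `μ` converges to `θ μ` in probability, the
probability being over both the sample and the internal randomness. -/
def IsConsistentEstimator (T : ∀ n : ℕ, (Fin n → ℝ × ℝ) → Measure ℝ)
    (θ : Measure (ℝ × ℝ) → ℝ) (𝒞 : Set (Measure (ℝ × ℝ))) : Prop :=
  ∀ μ ∈ 𝒞, ∀ τ : ℝ, 0 < τ →
    Tendsto (fun n : ℕ => ∫⁻ D, T n D {v | |v - θ μ| < τ} ∂(Measure.pi fun _ : Fin n => μ))
      atTop (𝓝 1)

/-- The laws of pairs of random variables with range bounded by `L`. -/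
def boundedLaws (L : Range) : Set (Measure (ℝ × ℝ)) :=
  {μ | IsProbabilityMeasure μ ∧ μ L.toSet = 1}

/-! ### The mechanism is well defined -/

theorem truncGeomWeight_nonneg {ε : ℝ} (hε : 0 < ε) (n f i : ℕ) : 0 ≤ truncGeomWeight ε n f i := by
  have h1 : Real.exp (-ε) ≤ 1 := Real.exp_le_one_iff.2 (by linarith)
  have h0 := Real.exp_pos (-ε)
  have h2 : 0 ≤ 1 - Real.exp (-ε) := by linarith
  unfold truncGeomWeight
  split_ifs <;> positivity

theorem truncGeom_middle_sum (ρ : ℝ) (m f : ℕ) (hf : f ≤ m + 1) :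
    ∑ i ∈ Finset.range m, (1 - ρ) * ρ ^ ((f : ℤ) - ((i + 1 : ℕ) : ℤ)).natAbs
      = 1 + ρ - ρ ^ f - ρ ^ (m + 1 - f) := by
  induction m generalizing f with
  | zero =>
    have : f = 0 ∨ f = 1 := by omega
    rcases this with rfl | rfl <;> simp
  | succ m ih =>
    rcases Nat.lt_or_ge (m + 1) f with h | h
    · have hfm : f = m + 2 := by omega
      subst hfm
      have key : ∀ j : ℕ, j ≤ m + 1 → ∑ i ∈ Finset.range j,
          (1 - ρ) * ρ ^ (((m + 2 : ℕ) : ℤ) - ((i + 1 : ℕ) : ℤ)).natAbs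
            = ρ ^ (m + 2 - j) - ρ ^ (m + 2) := by
        intro j hj
        induction j with
        | zero => simp
        | succ j ihj =>
          rw [Finset.sum_range_succ, ihj (by omega)]
          have e1 : (((m + 2 : ℕ) : ℤ) - ((j + 1 : ℕ) : ℤ)).natAbs = m + 2 - (j + 1) := by omega
          have e2 : m + 2 - j = (m + 2 - (j + 1)) + 1 := by omega
          rw [e1, e2, pow_succ]
          ring
      rw [key (m + 1) le_rfl]
      have e3 : m + 2 - (m + 1) = 1 := by omega
      have e4 : m + 1 + 1 - (m + 2) = 0 := by omega
      rw [e3, e4]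
      ring
    · rw [Finset.sum_range_succ, ih f h]
      have e1 : ((f : ℤ) - ((m + 1 : ℕ) : ℤ)).natAbs = m + 1 - f := by omega
      have e2 : m + 1 + 1 - f = (m + 1 - f) + 1 := by omega
      rw [e1, e2, pow_succ]
      ring

theorem isProbabilityMeasure_truncGeom {ε : ℝ} (hε : 0 < ε) {n f : ℕ} (hn : 0 < n) (hf : f ≤ n) :
    IsProbabilityMeasure (truncGeom ε n f) := by
  obtain ⟨m, rfl⟩ : ∃ m, n = m + 1 := ⟨n - 1, by omega⟩
  refine ⟨?_⟩
  have h : ∑ i ∈ Finset.range (m + 1 + 1), truncGeomWeight ε (m + 1) f i = 1 := by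
    rw [Finset.sum_range_succ, Finset.sum_range_succ']
    have h0 := Real.exp_pos (-ε)
    have hmid : ∑ i ∈ Finset.range m, truncGeomWeight ε (m + 1) f (i + 1)
        = (∑ i ∈ Finset.range m,
            (1 - Real.exp (-ε)) * Real.exp (-ε) ^ ((f : ℤ) - ((i + 1 : ℕ) : ℤ)).natAbs)
          / (1 + Real.exp (-ε)) := by
      rw [Finset.sum_div]
      refine Finset.sum_congr rfl fun i hi => ?_
      have hi' : i < m := Finset.mem_range.1 hi
      simp only [truncGeomWeight, Nat.succ_ne_zero, if_false, if_pos (Nat.succ_lt_succ hi')]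
      ring
    rw [hmid, truncGeom_middle_sum _ _ _ hf]
    simp only [truncGeomWeight, if_true, Nat.succ_ne_zero, if_false, lt_irrefl]
    field_simp
    ring
  simp only [truncGeom, Measure.coe_finsetSum, Finset.sum_apply, Measure.smul_apply,
    measure_univ, smul_eq_mul, mul_one]
  rw [← ENNReal.ofReal_sum_of_nonneg fun i _ => truncGeomWeight_nonneg hε _ _ _, h,
    ENNReal.ofReal_one]

theorem countMatrix_le (L : Range) (r s : ℕ) {n : ℕ} (D : Fin n → ℝ × ℝ) (i : Fin r) (j : Fin s) :
    countMatrix L r s D i j ≤ n := by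
  simpa [countMatrix] using Finite.card_subtype_le (α := Fin n)
    (fun m => (D m).1 ∈ rangePart L.x₀ L.x₁ s j ∧ (D m).2 ∈ rangePart L.y₀ L.y₁ r i)

theorem isProbabilityMeasure_noisyCountLaw (L : Range) (c : ℝ) {ε : ℝ} (hε : 0 < ε) {n : ℕ}
    (hn : 0 < n) (D : Fin n → ℝ × ℝ) (k l : ℕ) :
    IsProbabilityMeasure (noisyCountLaw L c ε D k l) := by
  have h := fun i j => isProbabilityMeasure_truncGeom (half_pos hε) hn
    (countMatrix_le L (masterRows c k l) (masterCols c k l) D i j)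
  unfold noisyCountLaw
  infer_instance

/-- Laws of the output exist, e.g. with independent noise for all `(k, ℓ)`. -/
theorem exists_isMICrGeom (L : Range) (B c : ℝ) {ε : ℝ} (hε : 0 < ε) {n : ℕ} (hn : 0 < n)
    (D : Fin n → ℝ × ℝ) : ∃ ρ : Measure ℝ, IsMICrGeom L B c ε D ρ := by
  have h := isProbabilityMeasure_noisyCountLaw L c hε hn D
  refine ⟨_, Measure.infinitePi fun k => Measure.infinitePi fun l => noisyCountLaw L c ε D k l,
    fun k l _ _ => ?_, rfl⟩
  have e : (fun A : NoisyCounts c => A k l) = (fun f => f l) ∘ (fun A : NoisyCounts c => A k) := rfl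
  rw [e, ← Measure.map_map (measurable_pi_apply l) (measurable_pi_apply k),
    Measure.infinitePi_map_eval, Measure.infinitePi_map_eval]

theorem measurable_micrGeomOutput (B c : ℝ) : Measurable (micrGeomOutput B c) := by
  unfold micrGeomOutput
  refine Measurable.iSup fun s => ?_
  exact (measurable_of_countable (noisyEntry c s.1.1 s.1.2)).comp
    ((measurable_pi_apply s.1.2).comp (measurable_pi_apply s.1.1))

end MICr

end

noncomputable section

namespace MICr

/-! The output is compared with its population version, in which the noisy frequencies on each
master grid are replaced by the true cell probabilities `masterLaw`.

Statistical error. A master grid with kℓ ≤ B has at most (c+1)B² cells. Hoeffding's inequality over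
all sign patterns of the cells (`measure_sum_abs_cellCount_sub_ge_le`) and an exponential moment of
the geometric noise (`noisyCountLaw_sum_abs_sub_ge_le`) keep the ℓ¹ errors of the counts below δn
for all (k, ℓ) at once, each outside an event of probability at most exp(O(B²) - κnδ²). The union
bound sees only the law of each single noise matrix, so the dependence between them is irrelevant.
With δ = n^(-(1/4 - α/2)), nδ² = n^(1/2+α) beats B² = O(n^(2α)) because α < 1/2. Merging cells
contracts ℓ¹ distance, so all subgrids are covered without a further union bound, and the entropy
modulus `abs_mutualInfo_sub_le` turns 3δ into an information error O(δ log n + B/n), which tends to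
0.

Population value. Every subgrid is a grid, so `MIC*` is an upper bound. Conversely, take a k × ℓ
grid of nearly optimal value, with k ≤ ℓ say. The master grids for (k, m) refine both axes as m
grows. Their rows can be merged to approximate the k given rows; their m columns cannot be merged,
but by data processing (`mutualInfo_pushMatrix_le`) they carry at least the information of any
merger approximating the ℓ given columns. Since min(k, m) = k, the normalization is unchanged. The
approximating labels converge at every point of `L`, grid lines included (`exists_cellIdx_approx`),
so atoms cause no trouble. -/

/-! ### Matrices and mutual information -/

/-- The matrix obtained from `p` by summing the entries over the fibers of `u` and `v`. -/
def pushMatrix {r s k l : ℕ} (u : Fin r → Fin k) (v : Fin s → Fin l) (p : Fin r → Fin s → ℝ) :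
    Fin k → Fin l → ℝ :=
  fun i j => ∑ a with u a = i, ∑ b with v b = j, p a b

theorem mergeMatrix_eq_pushMatrix {c : ℝ} {k l : ℕ}
    (p : Fin (masterRows c k l) → Fin (masterCols c k l) → ℝ) (G : SubGrid c k l) :
    mergeMatrix p G = pushMatrix G.1.1 G.2.1 p := by
  unfold mergeMatrix pushMatrix
  congr!

section pushMatrix

variable {r s k l : ℕ} (u : Fin r → Fin k) (v : Fin s → Fin l) (p q : Fin r → Fin s → ℝ)

theorem pushMatrix_nonneg {p : Fin r → Fin s → ℝ} (hp : ∀ a b, 0 ≤ p a b) (i : Fin k) (j : Fin l) :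
    0 ≤ pushMatrix u v p i j :=
  Finset.sum_nonneg fun _ _ => Finset.sum_nonneg fun _ _ => hp _ _

theorem sum_pushMatrix_row (i : Fin k) :
    ∑ j, pushMatrix u v p i j = ∑ a with u a = i, ∑ b, p a b := by
  unfold pushMatrix
  rw [Finset.sum_comm]
  exact Finset.sum_congr rfl fun a _ => Finset.sum_fiberwise _ _ _

theorem sum_pushMatrix_col (j : Fin l) :
    ∑ i, pushMatrix u v p i j = ∑ b with v b = j, ∑ a, p a b := by
  unfold pushMatrix
  rw [Finset.sum_fiberwise, Finset.sum_comm]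

theorem sum_pushMatrix : ∑ i, ∑ j, pushMatrix u v p i j = ∑ a, ∑ b, p a b := by
  simp_rw [sum_pushMatrix_row]
  exact Finset.sum_fiberwise _ _ _

theorem pushMatrix_sub : pushMatrix u v p - pushMatrix u v q = pushMatrix u v (p - q) := by
  funext i j
  simp [pushMatrix, Finset.sum_sub_distrib]

/-- Triangle inequality inside each merged block. An ℓ¹ bound on the master grid thus controls all
its subgrids simultaneously. -/
theorem sum_abs_pushMatrix_sub_le :
    ∑ i, ∑ j, |pushMatrix u v p i j - pushMatrix u v q i j| ≤ ∑ a, ∑ b, |p a b - q a b| := by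
  rw [← sum_pushMatrix u v fun a b => |p a b - q a b|]
  refine Finset.sum_le_sum fun i _ => Finset.sum_le_sum fun j _ => ?_
  have := congrFun (congrFun (pushMatrix_sub u v p q) i) j
  simp only [Pi.sub_apply] at this
  rw [this]
  exact (Finset.abs_sum_le_sum_abs _ _).trans
    (Finset.sum_le_sum fun a _ => Finset.abs_sum_le_sum_abs _ _)

theorem pushMatrix_pushMatrix {k' l' : ℕ} (u' : Fin k → Fin k') (v' : Fin l → Fin l') :
    pushMatrix u' v' (pushMatrix u v p) = pushMatrix (u' ∘ u) (v' ∘ v) p := by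
  have h : ∀ {r k k' : ℕ} (u : Fin r → Fin k) (u' : Fin k → Fin k') (i : Fin k') (f : Fin r → ℝ),
      ∑ x with u' x = i, ∑ a with u a = x, f a = ∑ a with (u' ∘ u) a = i, f a := by
    intro r k k' u u' i f
    rw [← Finset.sum_fiberwise_of_maps_to (g := u) (s := Finset.univ.filter fun a => (u' ∘ u) a = i)
      (t := Finset.univ.filter fun x => u' x = i) (by simp)]
    refine Finset.sum_congr rfl fun x hx => Finset.sum_congr ?_ fun _ _ => rfl
    ext a
    simp only [Finset.mem_filter, Finset.mem_univ, true_and, Function.comp_apply] at hx ⊢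
    constructor
    · rintro rfl; exact ⟨hx, rfl⟩
    · exact And.right
  funext i j
  unfold pushMatrix
  rw [← h]
  refine Finset.sum_congr rfl fun x _ => ?_
  rw [Finset.sum_comm]
  exact Finset.sum_congr rfl fun a _ => h _ _ _ _

end pushMatrix

/-- The log-sum inequality. -/
theorem log_sum_inequality {ι : Type*} (t : Finset ι) (x y : ι → ℝ) (hx : ∀ i ∈ t, 0 ≤ x i)
    (hy : ∀ i ∈ t, 0 ≤ y i) (hxy : ∀ i ∈ t, y i = 0 → x i = 0) :
    (∑ i ∈ t, x i) * Real.log ((∑ i ∈ t, x i) / ∑ i ∈ t, y i)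
      ≤ ∑ i ∈ t, x i * Real.log (x i / y i) := by
  set X := ∑ i ∈ t, x i with hX
  set Y := ∑ i ∈ t, y i with hY
  have hX0 : 0 ≤ X := Finset.sum_nonneg hx
  have hY0 : 0 ≤ Y := Finset.sum_nonneg hy
  rcases hX0.eq_or_lt with h | hXpos
  · have hz : ∀ i ∈ t, x i = 0 := (Finset.sum_eq_zero_iff_of_nonneg hx).1 h.symm
    rw [← h, Finset.sum_congr rfl fun i hi => by rw [hz i hi, zero_mul]]
    simp
  have hYpos : 0 < Y := by
    rcases hY0.eq_or_lt with h | h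
    · have hz := (Finset.sum_eq_zero_iff_of_nonneg hy).1 h.symm
      have : X = 0 := Finset.sum_eq_zero fun i hi => hxy i hi (hz i hi)
      linarith
    · exact h
  -- This is `1 - 1/u ≤ log u` at `u = (x i / y i) / (X / Y)`, multiplied by `x i`; the corrections
  -- `x i - y i * (X / Y)` sum to zero.
  have key : ∀ i ∈ t, x i * Real.log (X / Y) + (x i - y i * (X / Y)) ≤ x i * Real.log (x i / y i) := by
    intro i hi
    rcases (hx i hi).eq_or_lt with h | hxi
    · rw [← h]
      have := mul_nonneg (hy i hi) (div_pos hXpos hYpos).le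
      simp only [zero_mul]
      linarith
    have hyi : 0 < y i := (hy i hi).lt_of_ne fun h => hxi.ne' (hxy i hi h.symm)
    have h1 := Real.one_sub_inv_le_log_of_pos (show 0 < (x i / y i) / (X / Y) by positivity)
    rw [Real.log_div (by positivity) (by positivity)] at h1
    have h2 := mul_le_mul_of_nonneg_left h1 hxi.le
    have h3 : x i * (1 - (x i / y i / (X / Y))⁻¹) = x i - y i * (X / Y) := by
      field_simp
    rw [h3] at h2
    linarith
  calc X * Real.log (X / Y)
      = ∑ i ∈ t, (x i * Real.log (X / Y) + (x i - y i * (X / Y))) := by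
        rw [Finset.sum_add_distrib, Finset.sum_sub_distrib, ← Finset.sum_mul, ← Finset.sum_mul,
          ← hX, ← hY]
        field_simp
        ring
    _ ≤ _ := Finset.sum_le_sum key

theorem mutualInfo_eq_div {k l : ℕ} (p : Fin k → Fin l → ℝ) :
    mutualInfo p = (∑ i, ∑ j, p i j * Real.log (p i j / ((∑ j', p i j') * (∑ i', p i' j))))
      / Real.log 2 := by
  simp only [mutualInfo, Real.logb, Finset.sum_div, mul_div_assoc]

theorem entry_le_row {k l : ℕ} {p : Fin k → Fin l → ℝ} (hp : ∀ i j, 0 ≤ p i j) (i : Fin k)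
    (j : Fin l) : p i j ≤ ∑ j', p i j' :=
  Finset.single_le_sum (f := fun j' => p i j') (fun j' _ => hp i j') (Finset.mem_univ j)

theorem entry_le_col {k l : ℕ} {p : Fin k → Fin l → ℝ} (hp : ∀ i j, 0 ≤ p i j) (i : Fin k)
    (j : Fin l) : p i j ≤ ∑ i', p i' j :=
  Finset.single_le_sum (f := fun i' => p i' j) (fun i' _ => hp i' j) (Finset.mem_univ i)

/-- The data processing inequality for deterministic maps. -/
theorem mutualInfo_pushMatrix_le {r s k l : ℕ} (u : Fin r → Fin k) (v : Fin s → Fin l)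
    {p : Fin r → Fin s → ℝ} (hp : ∀ a b, 0 ≤ p a b) :
    mutualInfo (pushMatrix u v p) ≤ mutualInfo p := by
  rw [mutualInfo_eq_div, mutualInfo_eq_div]
  refine div_le_div_of_nonneg_right ?_ (Real.log_nonneg (by norm_num))
  rw [← sum_pushMatrix u v fun a b => p a b * Real.log (p a b / ((∑ j', p a j') * ∑ i', p i' b))]
  refine Finset.sum_le_sum fun i _ => Finset.sum_le_sum fun j _ => ?_
  rw [sum_pushMatrix_row, sum_pushMatrix_col, Finset.sum_mul_sum]
  unfold pushMatrix
  simp only [← Finset.sum_product']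
  -- Log-sum on one merged block: the weights are products of marginals, and these sum over the
  -- block to the product of the merged marginals.
  refine log_sum_inequality _ (fun x : Fin r × Fin s => p x.1 x.2)
    (fun x => (∑ b, p x.1 b) * ∑ a, p a x.2) (fun x _ => hp _ _)
    (fun x _ => mul_nonneg (Finset.sum_nonneg fun _ _ => hp _ _)
      (Finset.sum_nonneg fun _ _ => hp _ _)) fun x _ h => ?_
  refine le_antisymm ?_ (hp _ _)
  rcases mul_eq_zero.1 h with h | h
  · exact h ▸ entry_le_row hp x.1 x.2
  · exact h ▸ entry_le_col hp x.1 x.2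

theorem mutualInfo_eq_zero_of_row {l : ℕ} (p : Fin 1 → Fin l → ℝ)
    (h1 : ∑ i, ∑ j, p i j = 1) : mutualInfo p = 0 := by
  simp only [Finset.univ_unique, Finset.sum_singleton] at h1
  simp only [mutualInfo, Finset.univ_unique, Finset.sum_singleton, h1, one_mul]
  refine Finset.sum_eq_zero fun j _ => ?_
  by_cases h : p 0 j = 0 <;> simp [h]

/-- Data processing applied to the collapse of everything into a single cell, where the information
vanishes. -/
theorem mutualInfo_nonneg {k l : ℕ} {p : Fin k → Fin l → ℝ} (hp : ∀ i j, 0 ≤ p i j)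
    (h1 : ∑ i, ∑ j, p i j = 1) : 0 ≤ mutualInfo p := by
  have h := mutualInfo_pushMatrix_le (fun _ => (0 : Fin 1)) (fun _ => (0 : Fin 1)) hp
  rwa [mutualInfo_eq_zero_of_row _ ((sum_pushMatrix _ _ _).trans h1)] at h

theorem normMutualInfo_nonneg {k l : ℕ} {p : Fin k → Fin l → ℝ} (hp : ∀ i j, 0 ≤ p i j)
    (h1 : ∑ i, ∑ j, p i j = 1) (hk : 2 ≤ k) (hl : 2 ≤ l) : 0 ≤ normMutualInfo p :=
  div_nonneg (mutualInfo_nonneg hp h1)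
    (Real.logb_nonneg (by norm_num) (by exact_mod_cast (by omega : 1 ≤ min k l)))

theorem mutualInfo_swap {k l : ℕ} (p : Fin k → Fin l → ℝ) :
    mutualInfo (fun j i => p i j) = mutualInfo p := by
  unfold mutualInfo
  rw [Finset.sum_comm]
  simp only [mul_comm]

/-- Information is at most the entropy of the row marginal, because an entry is at most its column
sum; the log-sum inequality with unit weights bounds that entropy by the logarithm of the number of
rows. -/
theorem mutualInfo_le_logb_left {k l : ℕ} {p : Fin k → Fin l → ℝ} (hp : ∀ i j, 0 ≤ p i j)
    (h1 : ∑ i, ∑ j, p i j = 1) : mutualInfo p ≤ Real.logb 2 k := by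
  rw [mutualInfo_eq_div, Real.logb]
  refine div_le_div_of_nonneg_right ?_ (Real.log_nonneg (by norm_num))
  have h2 := log_sum_inequality Finset.univ (fun i => ∑ j, p i j) (fun _ => (1 : ℝ))
    (fun i _ => Finset.sum_nonneg fun j _ => hp i j) (fun _ _ => zero_le_one) (by simp)
  simp only [h1, Finset.sum_const, Finset.card_univ, Fintype.card_fin, nsmul_eq_mul, mul_one,
    div_one, one_mul, one_div, Real.log_inv] at h2
  suffices h : ∀ i, ∑ j, p i j * Real.log (p i j / ((∑ j', p i j') * (∑ i', p i' j)))
      ≤ -((∑ j, p i j) * Real.log (∑ j, p i j)) by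
    refine (Finset.sum_le_sum fun i _ => h i).trans ?_
    rw [Finset.sum_neg_distrib]
    linarith
  intro i
  rw [Finset.sum_mul, ← Finset.sum_neg_distrib]
  refine Finset.sum_le_sum fun j _ => ?_
  rcases (hp i j).eq_or_lt with h | h
  · simp [← h]
  have hr := h.trans_le (entry_le_row hp i j)
  have hc := h.trans_le (entry_le_col hp i j)
  rw [← mul_neg, ← Real.log_inv]
  refine mul_le_mul_of_nonneg_left (Real.log_le_log (by positivity) ?_) h.le
  rw [div_le_iff₀ (by positivity)]
  field_simp
  exact entry_le_col hp i j

theorem mutualInfo_le_logb_min {k l : ℕ} {p : Fin k → Fin l → ℝ} (hp : ∀ i j, 0 ≤ p i j)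
    (h1 : ∑ i, ∑ j, p i j = 1) : mutualInfo p ≤ Real.logb 2 ((min k l : ℕ) : ℝ) := by
  rcases min_choice k l with h | h <;> rw [h]
  · exact mutualInfo_le_logb_left hp h1
  · rw [← mutualInfo_swap]
    exact mutualInfo_le_logb_left (fun j i => hp i j) (Finset.sum_comm.trans h1)

theorem normMutualInfo_le_one {k l : ℕ} {p : Fin k → Fin l → ℝ} (hp : ∀ i j, 0 ≤ p i j)
    (h1 : ∑ i, ∑ j, p i j = 1) : normMutualInfo p ≤ 1 :=
  div_le_one_of_le₀ (mutualInfo_le_logb_min hp h1)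
    ((mutualInfo_nonneg hp h1).trans (mutualInfo_le_logb_min hp h1))

/-! ### Continuity of mutual information -/

/-- The form H(rows) + H(columns) - H(joint) has no quotients, so continuity reduces to that of
`Real.negMulLog`. Total mass one is not needed, which admits the zero matrix. -/
theorem mutualInfo_eq_negMulLog {k l : ℕ} {p : Fin k → Fin l → ℝ} (hp : ∀ i j, 0 ≤ p i j) :
    mutualInfo p = ((∑ i, Real.negMulLog (∑ j, p i j)) + (∑ j, Real.negMulLog (∑ i, p i j))
      - ∑ i, ∑ j, Real.negMulLog (p i j)) / Real.log 2 := by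
  rw [mutualInfo_eq_div]
  congr 1
  have h : ∀ i j, p i j * Real.log (p i j / ((∑ j', p i j') * (∑ i', p i' j)))
      = -p i j * Real.log (∑ j', p i j') + -p i j * Real.log (∑ i', p i' j)
        - Real.negMulLog (p i j) := by
    intro i j
    rcases (hp i j).eq_or_lt with h | h
    · simp [← h]
    have hr := h.trans_le (entry_le_row hp i j)
    have hc := h.trans_le (entry_le_col hp i j)
    rw [Real.log_div h.ne' (by positivity), Real.log_mul hr.ne' hc.ne', Real.negMulLog]
    ring
  simp_rw [h, Finset.sum_sub_distrib, Finset.sum_add_distrib]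
  congr 2
  · refine Finset.sum_congr rfl fun i _ => ?_
    rw [← Finset.sum_mul, Finset.sum_neg_distrib, Real.negMulLog]
  · rw [Finset.sum_comm]
    refine Finset.sum_congr rfl fun i _ => ?_
    rw [← Finset.sum_mul, Finset.sum_neg_distrib, Real.negMulLog]

theorem tendsto_mutualInfo {ι : Type*} {F : Filter ι} {k l : ℕ} {p : ι → Fin k → Fin l → ℝ}
    {q : Fin k → Fin l → ℝ} (hp : ∀ x i j, 0 ≤ p x i j) (hq : ∀ i j, 0 ≤ q i j)
    (h : ∀ i j, Tendsto (fun x => p x i j) F (𝓝 (q i j))) :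
    Tendsto (fun x => mutualInfo (p x)) F (𝓝 (mutualInfo q)) := by
  simp_rw [fun x => mutualInfo_eq_negMulLog (hp x), mutualInfo_eq_negMulLog hq]
  have hc := Real.continuous_negMulLog
  refine Tendsto.div_const (Tendsto.sub (Tendsto.add ?_ ?_) ?_) _
  · exact tendsto_finsetSum _ fun i _ => (hc.tendsto _).comp (tendsto_finsetSum _ fun j _ => h i j)
  · exact tendsto_finsetSum _ fun j _ => (hc.tendsto _).comp (tendsto_finsetSum _ fun i _ => h i j)
  · exact tendsto_finsetSum _ fun i _ => tendsto_finsetSum _ fun j _ => (hc.tendsto _).comp (h i j)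

/-- From `log u ≤ u - 1` at `u = t / d`. The bound is linear in `d`, so it can be summed over cells;
the free parameter `t` is later set to 1/n. -/
theorem negMulLog_le_mul_add {d t : ℝ} (hd : 0 ≤ d) (ht : 0 < t) :
    Real.negMulLog d ≤ d * Real.log (1 / t) + t := by
  rcases hd.eq_or_lt with rfl | hd
  · simp [ht.le]
  have h := Real.log_le_sub_one_of_pos (div_pos ht hd)
  rw [Real.log_div ht.ne' hd.ne'] at h
  have h2 := mul_le_mul_of_nonneg_left h hd.le
  have h3 : d * (t / d - 1) = t - d := by field_simp
  rw [one_div, Real.log_inv, Real.negMulLog]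
  linarith

theorem abs_negMulLog_sub_le_of_le {x y t : ℝ} (hx : 0 ≤ x) (hxy : x ≤ y) (hy : y ≤ 1)
    (ht : 0 < t) (ht1 : t ≤ 1) :
    |Real.negMulLog x - Real.negMulLog y| ≤ (y - x) * (1 + Real.log (1 / t)) + t := by
  have hlt : 0 ≤ Real.log (1 / t) := Real.log_nonneg (by rw [le_div_iff₀ ht]; linarith)
  have hd : 0 ≤ y - x := sub_nonneg.2 hxy
  have h1 := negMulLog_le_mul_add hd ht
  rcases hx.eq_or_lt with rfl | hx
  · simp only [Real.negMulLog_zero, zero_sub, sub_zero, abs_neg] at h1 ⊢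
    rw [abs_of_nonneg (Real.negMulLog_nonneg hxy hy)]
    linarith
  rcases hxy.eq_or_lt with rfl | hlt'
  · simp [ht.le]
  have hy0 : 0 < y := hx.trans hlt'
  have hdpos : 0 < y - x := sub_pos.2 hlt'
  simp only [Real.negMulLog] at h1 ⊢
  have hlx : Real.log x ≤ Real.log y := Real.log_le_log hx hxy
  have hld : Real.log (y - x) ≤ Real.log y := Real.log_le_log hdpos (by linarith)
  have e1 := mul_le_mul_of_nonneg_left hlx hx.le
  have e2 := mul_le_mul_of_nonneg_left hld hdpos.le
  have h3 := Real.log_le_sub_one_of_pos (div_pos hy0 hx)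
  rw [Real.log_div hy0.ne' hx.ne'] at h3
  have h4 := mul_le_mul_of_nonneg_left h3 hx.le
  have h5 : x * (y / x - 1) = y - x := by field_simp
  have h6 : (y - x) * Real.log y ≤ 0 :=
    mul_nonpos_of_nonneg_of_nonpos hd (Real.log_nonpos hy0.le hy)
  have h7 := mul_nonneg hd hlt
  -- With φ = `Real.negMulLog`: φ(y) - φ(x) ≤ φ(y - x) follows from `e1`, `e2` and is bounded by
  -- `h1`; φ(x) - φ(y) = x log(y/x) + (y - x) log y ≤ y - x follows from `h4`, `h6`.
  rw [abs_le]
  constructor <;> nlinarith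

theorem abs_negMulLog_sub_le {x y t : ℝ} (hx : 0 ≤ x) (hx1 : x ≤ 1) (hy : 0 ≤ y) (hy1 : y ≤ 1)
    (ht : 0 < t) (ht1 : t ≤ 1) :
    |Real.negMulLog x - Real.negMulLog y| ≤ |x - y| * (1 + Real.log (1 / t)) + t := by
  rcases le_total x y with h | h
  · rw [abs_sub_comm x y, abs_of_nonneg (sub_nonneg.2 h)]
    exact abs_negMulLog_sub_le_of_le hx h hy1 ht ht1
  · rw [abs_sub_comm (Real.negMulLog x), abs_of_nonneg (sub_nonneg.2 h)]
    exact abs_negMulLog_sub_le_of_le hy h hx1 ht ht1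

theorem abs_sum_negMulLog_sub_le {ι : Type*} (s : Finset ι) {x y : ι → ℝ} {t : ℝ}
    (hx : ∀ i ∈ s, 0 ≤ x i ∧ x i ≤ 1) (hy : ∀ i ∈ s, 0 ≤ y i ∧ y i ≤ 1) (ht : 0 < t) (ht1 : t ≤ 1) :
    |∑ i ∈ s, Real.negMulLog (x i) - ∑ i ∈ s, Real.negMulLog (y i)|
      ≤ (∑ i ∈ s, |x i - y i|) * (1 + Real.log (1 / t)) + s.card * t := by
  rw [← Finset.sum_sub_distrib, Finset.sum_mul, ← nsmul_eq_mul, ← Finset.sum_const,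
    ← Finset.sum_add_distrib]
  exact (Finset.abs_sum_le_sum_abs _ _).trans (Finset.sum_le_sum fun i hi =>
    abs_negMulLog_sub_le (hx i hi).1 (hx i hi).2 (hy i hi).1 (hy i hi).2 ht ht1)

/-- A modulus of continuity of mutual information with respect to the `ℓ¹` distance. -/
theorem abs_mutualInfo_sub_le {k l : ℕ} {p q : Fin k → Fin l → ℝ} {t : ℝ} (hk : 0 < k) (hl : 0 < l)
    (hp : ∀ i j, 0 ≤ p i j) (hp1 : ∑ i, ∑ j, p i j ≤ 1) (hq : ∀ i j, 0 ≤ q i j)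
    (hq1 : ∑ i, ∑ j, q i j ≤ 1) (ht : 0 < t) (ht1 : t ≤ 1) :
    |mutualInfo p - mutualInfo q| ≤
      3 * ((∑ i, ∑ j, |p i j - q i j|) * (1 + Real.log (1 / t)) + k * l * t) / Real.log 2 := by
  have hl2 : 0 < Real.log 2 := Real.log_pos (by norm_num)
  have hlt : 0 ≤ 1 + Real.log (1 / t) :=
    add_nonneg zero_le_one (Real.log_nonneg (by rw [le_div_iff₀ ht]; linarith))
  rw [mutualInfo_eq_negMulLog hp, mutualInfo_eq_negMulLog hq, ← sub_div, abs_div, abs_of_pos hl2]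
  refine div_le_div_of_nonneg_right ?_ hl2.le
  set S := ∑ i, ∑ j, |p i j - q i j| with hS
  have row : ∀ {p : Fin k → Fin l → ℝ}, (∀ i j, 0 ≤ p i j) → ∑ i, ∑ j, p i j ≤ 1 →
      ∀ i, 0 ≤ ∑ j, p i j ∧ ∑ j, p i j ≤ 1 := fun hp hp1 i =>
    ⟨Finset.sum_nonneg fun j _ => hp i j, (Finset.single_le_sum (f := fun i => ∑ j, _)
      (fun i _ => Finset.sum_nonneg fun j _ => hp i j) (Finset.mem_univ i)).trans hp1⟩
  have col : ∀ {p : Fin k → Fin l → ℝ}, (∀ i j, 0 ≤ p i j) → ∑ i, ∑ j, p i j ≤ 1 →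
      ∀ j, 0 ≤ ∑ i, p i j ∧ ∑ i, p i j ≤ 1 := fun hp hp1 j =>
    ⟨Finset.sum_nonneg fun i _ => hp i j, (Finset.single_le_sum (f := fun j => ∑ i, _)
      (fun j _ => Finset.sum_nonneg fun i _ => hp i j) (Finset.mem_univ j)).trans
        (Finset.sum_comm.trans_le hp1)⟩
  have hkr : (1 : ℝ) ≤ k := by exact_mod_cast hk
  have hlr : (1 : ℝ) ≤ l := by exact_mod_cast hl
  have h1 := abs_sum_negMulLog_sub_le Finset.univ (fun i _ => row hp hp1 i)
    (fun i _ => row hq hq1 i) ht ht1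
  have h2 := abs_sum_negMulLog_sub_le Finset.univ (fun j _ => col hp hp1 j)
    (fun j _ => col hq hq1 j) ht ht1
  have h3 := abs_sum_negMulLog_sub_le (Finset.univ : Finset (Fin k × Fin l))
    (x := fun z => p z.1 z.2) (y := fun z => q z.1 z.2)
    (fun z _ => ⟨hp _ _, (entry_le_row hp z.1 z.2).trans (row hp hp1 z.1).2⟩)
    (fun z _ => ⟨hq _ _, (entry_le_row hq z.1 z.2).trans (row hq hq1 z.1).2⟩) ht ht1
  simp only [Fintype.sum_prod_type, Finset.card_univ, Fintype.card_prod, Fintype.card_fin,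
    Nat.cast_mul] at h1 h2 h3
  have s1 : ∑ i, |∑ j, p i j - ∑ j, q i j| ≤ S := Finset.sum_le_sum fun i _ => by
    rw [← Finset.sum_sub_distrib]; exact Finset.abs_sum_le_sum_abs _ _
  have s2 : ∑ j, |∑ i, p i j - ∑ i, q i j| ≤ S := by
    rw [hS, Finset.sum_comm]
    exact Finset.sum_le_sum fun i _ => by
      rw [← Finset.sum_sub_distrib]; exact Finset.abs_sum_le_sum_abs _ _
  have s1' := mul_le_mul_of_nonneg_right s1 hlt
  have s2' := mul_le_mul_of_nonneg_right s2 hlt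
  have t1 : (k : ℝ) * t ≤ k * l * t := by
    refine mul_le_mul_of_nonneg_right ?_ ht.le; nlinarith
  have t2 : (l : ℝ) * t ≤ k * l * t := by
    refine mul_le_mul_of_nonneg_right ?_ ht.le; nlinarith
  -- The row, column and joint entropies each change by at most `S * (1 + log (1/t)) + k * l * t`,
  -- whence the factor 3.
  rw [abs_le] at h1 h2 h3 ⊢
  constructor <;> linarith [h1.1, h1.2, h2.1, h2.2, h3.1, h3.2]

theorem abs_normMutualInfo_sub_le {k l : ℕ} {p q : Fin k → Fin l → ℝ} (hk : 2 ≤ k) (hl : 2 ≤ l) :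
    |normMutualInfo p - normMutualInfo q| ≤ |mutualInfo p - mutualInfo q| := by
  have h : 1 ≤ Real.logb 2 ((min k l : ℕ) : ℝ) := by
    rw [Real.le_logb_iff_rpow_le (by norm_num) (by positivity), Real.rpow_one]
    exact_mod_cast le_min hk hl
  rw [normMutualInfo, normMutualInfo, ← sub_div, abs_div, abs_of_pos (zero_lt_one.trans_le h)]
  exact div_le_self (abs_nonneg _) h

/-! ### Cells of a range equipartition -/

/-- The index of the cell of the size-`m` range equipartition of `[a, b]` that contains `x`, the
extreme cells being extended to infinity. -/
def cellIdx (a b : ℝ) {m : ℕ} (hm : 0 < m) (x : ℝ) : Fin m :=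
  ⟨min ⌊(x - a) / ((b - a) / m)⌋₊ (m - 1), by omega⟩

section cellIdx

variable {a b : ℝ} {m : ℕ}

theorem cellIdx_monotone (hab : a < b) (hm : 0 < m) : Monotone (cellIdx a b hm) := by
  intro x y hxy
  have hw : 0 < (b - a) / m := div_pos (sub_pos.2 hab) (by exact_mod_cast hm)
  refine Fin.mk_le_mk.2 (min_le_min_right _ (Nat.floor_mono ?_))
  exact div_le_div_of_nonneg_right (by linarith) hw.le

/-- The truncation at `m - 1` in `cellIdx` only matters at `x = b`, and corresponds to the last cell
being closed. -/
theorem mem_rangePart_iff (hab : a < b) (hm : 0 < m) {x : ℝ} (hx : x ∈ Icc a b) (i : Fin m) :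
    x ∈ rangePart a b m i ↔ cellIdx a b hm x = i := by
  have hmr : (0 : ℝ) < m := by exact_mod_cast hm
  have hw : 0 < (b - a) / m := div_pos (sub_pos.2 hab) hmr
  have hwm : m * ((b - a) / m) = b - a := by field_simp
  have hq : 0 ≤ (x - a) / ((b - a) / m) := div_nonneg (sub_nonneg.2 hx.1) hw.le
  have hi := i.2
  have hle : (i : ℕ) ≤ ⌊(x - a) / ((b - a) / m)⌋₊ ↔ a + i * ((b - a) / m) ≤ x := by
    rw [Nat.le_floor_iff hq, le_div_iff₀ hw]
    constructor <;> intro h <;> linarith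
  have hlt : ⌊(x - a) / ((b - a) / m)⌋₊ < (i : ℕ) + 1 ↔ x < a + (i + 1) * ((b - a) / m) := by
    rw [Nat.floor_lt hq, div_lt_iff₀ hw]
    push_cast
    constructor <;> intro h <;> linarith
  have hlast : (i : ℕ) + 1 = m → a + ((i : ℕ) + 1 : ℝ) * ((b - a) / m) = b := by
    intro h
    have : ((i : ℕ) : ℝ) + 1 = m := by exact_mod_cast h
    rw [this, hwm]; ring
  simp only [rangePart, mem_ofPred_eq, ← hle, ← hlt, cellIdx, Fin.ext_iff]
  constructor
  · rintro ⟨h1, h2 | ⟨h2, -⟩⟩ <;> omega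
  · intro h
    refine ⟨by omega, ?_⟩
    by_cases h2 : (i : ℕ) + 1 = m
    · rcases hx.2.lt_or_eq with h3 | h3
      · exact Or.inl (hlt.2 (h3.trans_eq (hlast h2).symm))
      · exact Or.inr ⟨h2, h3⟩
    · left; omega

theorem exists_mem_cellIdx_eq (hab : a < b) (hm : 0 < m) (i : Fin m) :
    ∃ x ∈ Icc a b, cellIdx a b hm x = i := by
  have hmr : (0 : ℝ) < m := by exact_mod_cast hm
  have hw : 0 < (b - a) / m := div_pos (sub_pos.2 hab) hmr
  have hwm : m * ((b - a) / m) = b - a := by field_simp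
  have him : (i : ℝ) ≤ m := by exact_mod_cast i.2.le
  have h0 : (0 : ℝ) ≤ (i : ℕ) := by positivity
  have hx : a + i * ((b - a) / m) ∈ Icc a b := ⟨by nlinarith, by nlinarith⟩
  refine ⟨_, hx, (mem_rangePart_iff hab hm hx i).1 ⟨le_rfl, Or.inl ?_⟩⟩
  nlinarith

theorem abs_sub_le_of_cellIdx_eq (hab : a < b) (hm : 0 < m) {x y : ℝ} (hx : x ∈ Icc a b)
    (hy : y ∈ Icc a b) (h : cellIdx a b hm x = cellIdx a b hm y) : |x - y| ≤ (b - a) / m := by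
  have hmr : (0 : ℝ) < m := by exact_mod_cast hm
  have hwm : m * ((b - a) / m) = b - a := by field_simp
  have key : ∀ z ∈ Icc a b, cellIdx a b hm z = cellIdx a b hm y →
      a + (cellIdx a b hm y : ℕ) * ((b - a) / m) ≤ z ∧
      z ≤ a + ((cellIdx a b hm y : ℕ) + 1) * ((b - a) / m) := by
    intro z hz hzy
    obtain ⟨h1, h2⟩ := (mem_rangePart_iff hab hm hz _).2 hzy
    refine ⟨h1, ?_⟩
    rcases h2 with h2 | ⟨h2, h3⟩
    · exact h2.le
    · have : ((cellIdx a b hm y : ℕ) : ℝ) + 1 = m := by exact_mod_cast h2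
      rw [this, hwm, h3]; linarith
  have h1 := key x hx h
  have h2 := key y hy rfl
  rw [abs_le]
  constructor <;> linarith [h1.1, h1.2, h2.1, h2.2]

end cellIdx

/-! ### Grids from monotone maps -/

theorem measurable_of_ordConnected_fibers {k : ℕ} {f : ℝ → Fin k}
    (hf : ∀ i, (f ⁻¹' {i}).OrdConnected) : Measurable f :=
  measurable_to_countable' fun i => (hf i).measurableSet

theorem ordConnected_fiber_of_monotone {k : ℕ} {f : ℝ → Fin k} (hf : Monotone f) (i : Fin k) :
    (f ⁻¹' {i}).OrdConnected :=
  ⟨fun _ hx _ hy _ hz => le_antisymm ((hf hz.2).trans_eq hy) ((Eq.symm hx).trans_le (hf hz.1))⟩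

theorem measurable_of_monotone_fin {k : ℕ} {f : ℝ → Fin k} (hf : Monotone f) : Measurable f :=
  measurable_of_ordConnected_fibers (ordConnected_fiber_of_monotone hf)

/-- The partition of the line into the fibers of a monotone surjection. -/
def IntervalPartition.ofMonotone {k : ℕ} (f : ℝ → Fin k) (hf : Monotone f)
    (hs : Function.Surjective f) : IntervalPartition k where
  part i := f ⁻¹' {i}
  ordConnected := ordConnected_fiber_of_monotone hf
  nonempty i := hs i
  disjoint i j hij := Set.disjoint_left.2 fun x hx hx' => hij (hx.symm.trans hx')
  cover := by ext x; simp

/-- The matrix of the joint law of `F Y` and `H X`, where `μ` is the law of `(X, Y)`. -/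
def lawMatrix (μ : Measure (ℝ × ℝ)) {r s : ℕ} (F : ℝ → Fin r) (H : ℝ → Fin s) :
    Fin r → Fin s → ℝ :=
  fun i j => μ.real {z | F z.2 = i ∧ H z.1 = j}

section lawMatrix

variable {μ : Measure (ℝ × ℝ)} {r s k l : ℕ} {F : ℝ → Fin r} {H : ℝ → Fin s}

theorem lawMatrix_nonneg (i : Fin r) (j : Fin s) : 0 ≤ lawMatrix μ F H i j := measureReal_nonneg

theorem measurable_pair (hF : Measurable F) (hH : Measurable H) :
    Measurable fun z : ℝ × ℝ => (F z.2, H z.1) :=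
  (hF.comp measurable_snd).prodMk (hH.comp measurable_fst)

theorem measurableSet_cell (hF : Measurable F) (hH : Measurable H) (i : Fin r) (j : Fin s) :
    MeasurableSet {z : ℝ × ℝ | F z.2 = i ∧ H z.1 = j} := by
  have : {z : ℝ × ℝ | F z.2 = i ∧ H z.1 = j} = (fun z => (F z.2, H z.1)) ⁻¹' {(i, j)} := by
    ext z; simp
  rw [this]
  exact measurable_pair hF hH (measurableSet_singleton _)

/-- Additivity of `μ` over fibers. This lets grids be handled as labelling functions, with
coarsening as composition. -/
theorem lawMatrix_comp [IsFiniteMeasure μ] (hF : Measurable F) (hH : Measurable H)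
    (u : Fin r → Fin k) (v : Fin s → Fin l) :
    lawMatrix μ (u ∘ F) (v ∘ H) = pushMatrix u v (lawMatrix μ F H) := by
  funext i j
  unfold pushMatrix lawMatrix
  rw [← Finset.sum_product']
  have h := sum_measureReal_preimage_singleton (μ := μ)
    ((Finset.univ.filter fun a => u a = i) ×ˢ (Finset.univ.filter fun b => v b = j))
    (f := fun z : ℝ × ℝ => (F z.2, H z.1))
    fun y _ => measurable_pair hF hH (measurableSet_singleton y)
  have e : ∀ y : Fin r × Fin s, (fun z : ℝ × ℝ => (F z.2, H z.1)) ⁻¹' {y}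
      = {z | F z.2 = y.1 ∧ H z.1 = y.2} := fun y => by ext z; simp [Prod.ext_iff]
  simp_rw [e] at h
  rw [h]
  congr 1
  ext z
  simp

theorem sum_lawMatrix [IsProbabilityMeasure μ] (hF : Measurable F) (hH : Measurable H) :
    ∑ i, ∑ j, lawMatrix μ F H i j = 1 := by
  rw [← sum_pushMatrix (fun _ => (0 : Fin 1)) (fun _ => (0 : Fin 1)), ← lawMatrix_comp hF hH]
  simp [lawMatrix]

end lawMatrix

/-- The cell probabilities of the `r × s` grid of range equipartitions of `L`. -/
def masterLaw (μ : Measure (ℝ × ℝ)) (L : Range) {r s : ℕ} (hr : 0 < r) (hs : 0 < s) :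
    Fin r → Fin s → ℝ :=
  lawMatrix μ (cellIdx L.y₀ L.y₁ hr) (cellIdx L.x₀ L.x₁ hs)

section masterLaw

variable (μ : Measure (ℝ × ℝ)) (L : Range) {r s : ℕ} (hr : 0 < r) (hs : 0 < s)

theorem measurable_cellIdx_y : Measurable (cellIdx L.y₀ L.y₁ hr) :=
  measurable_of_monotone_fin (cellIdx_monotone L.y_lt hr)

theorem measurable_cellIdx_x : Measurable (cellIdx L.x₀ L.x₁ hs) :=
  measurable_of_monotone_fin (cellIdx_monotone L.x_lt hs)

theorem masterLaw_nonneg (i : Fin r) (j : Fin s) : 0 ≤ masterLaw μ L hr hs i j :=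
  lawMatrix_nonneg i j

theorem sum_masterLaw [IsProbabilityMeasure μ] : ∑ i, ∑ j, masterLaw μ L hr hs i j = 1 :=
  sum_lawMatrix (measurable_cellIdx_y L hr) (measurable_cellIdx_x L hs)

/-- The cell probabilities of a subgrid are those of a grid on the whole plane. -/
theorem exists_grid_gridProb_eq [IsFiniteMeasure μ] {k l : ℕ} {g : Fin r → Fin k}
    {h : Fin s → Fin l} (hg : Monotone g) (hg' : Function.Surjective g) (hh : Monotone h)
    (hh' : Function.Surjective h) :
    ∃ G : Grid k l, gridProb μ G = pushMatrix g h (masterLaw μ L hr hs) := by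
  have sy : Function.Surjective (cellIdx L.y₀ L.y₁ hr) := fun i =>
    (exists_mem_cellIdx_eq L.y_lt hr i).imp fun _ => And.right
  have sx : Function.Surjective (cellIdx L.x₀ L.x₁ hs) := fun i =>
    (exists_mem_cellIdx_eq L.x_lt hs i).imp fun _ => And.right
  refine ⟨⟨.ofMonotone _ (hg.comp (cellIdx_monotone L.y_lt hr)) (hg'.comp sy),
    .ofMonotone _ (hh.comp (cellIdx_monotone L.x_lt hs)) (hh'.comp sx)⟩, ?_⟩
  rw [masterLaw, ← lawMatrix_comp (measurable_cellIdx_y L hr) (measurable_cellIdx_x L hs)]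
  funext i j
  simp only [gridProb, lawMatrix, IntervalPartition.ofMonotone]
  congr 1
  ext z
  simp [and_comm]

end masterLaw

/-- The index of the part that contains `x`. -/
def IntervalPartition.index {k : ℕ} (P : IntervalPartition k) (x : ℝ) : Fin k :=
  (mem_iUnion.1 (P.cover.symm ▸ mem_univ x : x ∈ ⋃ i, P.part i)).choose

theorem IntervalPartition.mem_part_iff {k : ℕ} (P : IntervalPartition k) (x : ℝ) (i : Fin k) :
    x ∈ P.part i ↔ P.index x = i := by
  have h : x ∈ P.part (P.index x) :=
    (mem_iUnion.1 (P.cover.symm ▸ mem_univ x : x ∈ ⋃ i, P.part i)).choose_spec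
  constructor
  · intro hi
    by_contra hne
    exact Set.disjoint_left.1 (P.disjoint hne) h hi
  · rintro rfl
    exact h

theorem IntervalPartition.ordConnected_index {k : ℕ} (P : IntervalPartition k) (i : Fin k) :
    (P.index ⁻¹' {i}).OrdConnected := by
  have : P.index ⁻¹' {i} = P.part i := by ext x; simp [P.mem_part_iff]
  exact this ▸ P.ordConnected i

theorem gridProb_eq_lawMatrix (μ : Measure (ℝ × ℝ)) {k l : ℕ} (G : Grid k l) :
    gridProb μ G = lawMatrix μ G.rows.index G.cols.index := by
  funext i j
  simp only [gridProb, lawMatrix]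
  congr 1
  ext z
  simp [IntervalPartition.mem_part_iff, and_comm]

theorem sum_gridProb (μ : Measure (ℝ × ℝ)) [IsProbabilityMeasure μ] {k l : ℕ} (G : Grid k l) :
    ∑ i, ∑ j, gridProb μ G i j = 1 := by
  rw [gridProb_eq_lawMatrix]
  exact sum_lawMatrix (measurable_of_ordConnected_fibers G.rows.ordConnected_index)
    (measurable_of_ordConnected_fibers G.cols.ordConnected_index)

/-! ### Bounds on `MIC*` -/

section micStar

variable (μ : Measure (ℝ × ℝ)) [IsProbabilityMeasure μ]

theorem normMutualInfo_gridProb_le_one {k l : ℕ} (G : Grid k l) :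
    normMutualInfo (gridProb μ G) ≤ 1 :=
  normMutualInfo_le_one (fun _ _ => measureReal_nonneg) (sum_gridProb μ G)

theorem charMatrix_le_one (k l : ℕ) : charMatrix μ k l ≤ 1 :=
  Real.iSup_le (fun G => normMutualInfo_gridProb_le_one μ G) zero_le_one

theorem normMutualInfo_le_micStar {k l : ℕ} (hk : 2 ≤ k) (hl : 2 ≤ l) (G : Grid k l) :
    normMutualInfo (gridProb μ G) ≤ micStar μ :=
  (le_ciSup (f := fun G : Grid k l => normMutualInfo (gridProb μ G))
    ⟨1, forall_mem_range.2 (normMutualInfo_gridProb_le_one μ)⟩ G).trans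
    (le_ciSup (f := fun s : {s : ℕ × ℕ // 2 ≤ s.1 ∧ 2 ≤ s.2} => charMatrix μ s.1.1 s.1.2)
      ⟨1, forall_mem_range.2 fun _ => charMatrix_le_one μ _ _⟩ ⟨(k, l), hk, hl⟩)

theorem micStar_nonneg : 0 ≤ micStar μ :=
  Real.iSup_nonneg fun s => Real.iSup_nonneg fun G =>
    normMutualInfo_nonneg (fun _ _ => measureReal_nonneg) (sum_gridProb μ G) s.2.1 s.2.2

-- Nonnegativity of `θ` is what `Real.iSup_le` needs, since a real supremum over an empty family is
-- 0.
omit [IsProbabilityMeasure μ] in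
theorem exists_grid_of_lt_micStar {θ : ℝ} (h0 : 0 ≤ θ) (h : θ < micStar μ) :
    ∃ k l : ℕ, 2 ≤ k ∧ 2 ≤ l ∧ ∃ G : Grid k l, θ < normMutualInfo (gridProb μ G) := by
  by_contra! hcon
  exact h.not_ge (Real.iSup_le (fun s => Real.iSup_le
    (fun G => hcon _ _ s.2.1 s.2.2 G) h0) h0)

end micStar

/-! ### Approximation of grids by subgrids of master grids -/

/-- A monotone map to a finite type is constant on intervals that avoid a finite set. -/
theorem exists_finite_jumps {k : ℕ} {f : ℝ → Fin k} (hf : Monotone f) :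
    ∃ S : Set ℝ, S.Finite ∧ ∀ x y, x ≤ y → f x ≠ f y → ∃ s ∈ S, s ∈ Icc x y := by
  -- The jump into level `i` occurs at the infimum of the superlevel set. Only `i = f y` is used,
  -- whose set contains `y` and is bounded below by `x`, so junk values of `sInf` are harmless.
  refine ⟨range fun i => sInf {x | i ≤ f x}, finite_range _, fun x y hxy hne => ?_⟩
  have hlt : f x < f y := lt_of_le_of_ne (hf hxy) hne
  have hb : ∀ z ∈ {z | f y ≤ f z}, x ≤ z := fun z hz =>
    le_of_lt (hf.reflect_lt (hlt.trans_le hz))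
  exact ⟨_, ⟨f y, rfl⟩, le_csInf ⟨y, le_refl (f y)⟩ hb, csInf_le ⟨x, hb⟩ (le_refl (f y))⟩

/-- A monotone map to a finite type is the pointwise limit of monotone maps that are constant on
the cells of the size-`m` range equipartitions. -/
theorem exists_cellIdx_approx {a b : ℝ} (hab : a < b) {k : ℕ} {f : ℝ → Fin k} (hf : Monotone f) :
    ∃ g : ∀ m : ℕ, Fin m → Fin k, (∀ m, Monotone (g m)) ∧
      ∀ y ∈ Icc a b, ∀ᶠ m in atTop, ∀ hm : 0 < m, g m (cellIdx a b hm y) = f y := by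
  obtain ⟨S, hS, hjump⟩ := exists_finite_jumps hf
  -- Each cell takes the label of a representative, chosen to be a jump point whenever the cell
  -- contains one. This secures convergence at the jump points themselves.
  have hpt : ∀ (m : ℕ) (i : Fin m), ∃ x ∈ Icc a b, cellIdx a b i.pos x = i ∧
      ((∃ s ∈ S ∩ Icc a b, cellIdx a b i.pos s = i) → x ∈ S) := by
    intro m i
    by_cases h : ∃ s ∈ S ∩ Icc a b, cellIdx a b i.pos s = i
    · obtain ⟨s, hs, hsi⟩ := h
      exact ⟨s, hs.2, hsi, fun _ => hs.1⟩
    · obtain ⟨x, hx, hxi⟩ := exists_mem_cellIdx_eq hab i.pos i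
      exact ⟨x, hx, hxi, fun h' => absurd h' h⟩
  choose pt hpt_mem hpt_cell hpt_S using hpt
  refine ⟨fun m i => f (pt m i), fun m i j hij => ?_, fun y hy => ?_⟩
  · rcases hij.eq_or_lt with rfl | hlt
    · exact le_rfl
    · refine hf (le_of_lt ((cellIdx_monotone hab i.pos).reflect_lt ?_))
      rw [hpt_cell]
      exact hlt.trans_eq (hpt_cell m j).symm
  have hw : Tendsto (fun m : ℕ => (b - a) / (m : ℝ)) atTop (𝓝 0) :=
    tendsto_const_div_atTop_nhds_zero_nat _
  have hev : ∀ᶠ m : ℕ in atTop, ∀ s ∈ S, s ≠ y → (b - a) / (m : ℝ) < |s - y| := by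
    rw [eventually_all_finite hS]
    intro s _
    by_cases hsy : s = y
    · simp [hsy]
    · filter_upwards [hw.eventually_lt_const (abs_pos.2 (sub_ne_zero.2 hsy))] with m hm _ using hm
  filter_upwards [hev] with m hm hm0
  set x := pt m (cellIdx a b hm0 y) with hx
  have hxc : cellIdx a b hm0 x = cellIdx a b hm0 y := hpt_cell m _
  have hxy := abs_sub_le_of_cellIdx_eq hab hm0 (hpt_mem m _) hy hxc
  -- If the labels at `x` and `y` differ, some jump lies between them, hence within one cell width
  -- of `y`, so it is `y` itself. The representative `x` is then also a jump point, and for the same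
  -- reason equals `y`.
  by_contra hne
  have hs : ∃ s ∈ S, |s - y| ≤ |x - y| := by
    rcases le_total x y with h | h
    · obtain ⟨s, hs, hsi⟩ := hjump x y h hne
      exact ⟨s, hs, by rw [abs_of_nonpos, abs_of_nonpos] <;> linarith [hsi.1, hsi.2]⟩
    · obtain ⟨s, hs, hsi⟩ := hjump y x h (Ne.symm hne)
      exact ⟨s, hs, by rw [abs_of_nonneg, abs_of_nonneg] <;> linarith [hsi.1, hsi.2]⟩
  obtain ⟨s, hs, hsy⟩ := hs
  have hys : s = y := by
    by_contra h
    exact absurd (hm s hs h) (not_lt.2 (hsy.trans hxy))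
  have hxS : x ∈ S := hpt_S m _ ⟨y, ⟨hys ▸ hs, hy⟩, rfl⟩
  have : x = y := by
    by_contra h
    exact absurd (hm x hxS h) (not_lt.2 hxy)
  exact hne (by rw [this])

/-- An interval partition is, on `[a, b]`, a relabelling of a monotone map all of whose values are
attained on `[a, b]`. -/
theorem IntervalPartition.exists_monotone {k : ℕ} (P : IntervalPartition k) {a b : ℝ}
    (hab : a ≤ b) :
    ∃ k' ≤ k, ∃ F : ℝ → Fin k', Monotone F ∧ (∀ i, ∃ y ∈ Icc a b, F y = i) ∧
      ∃ u : Fin k' → Fin k, ∀ y ∈ Icc a b, u (F y) = P.index y := by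
  -- The parts may be listed in any order and may miss `[a, b]`. Sending a clamped point to a
  -- representative of its part gives a real-valued map with finite range, whose values can be
  -- ranked.
  have ht : ∀ i : Fin k, ∃ t : ℝ, (∃ y ∈ Icc a b, P.index y = i) → t ∈ Icc a b ∧ P.index t = i := by
    intro i
    by_cases h : ∃ y ∈ Icc a b, P.index y = i
    · exact h.imp fun y hy _ => hy
    · exact ⟨0, fun h' => absurd h' h⟩
  choose t ht using ht
  set cl : ℝ → ℝ := fun y => projIcc a b hab y with hcl
  have hclm : ∀ y, cl y ∈ Icc a b := fun y => (projIcc a b hab y).2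
  have hcle : ∀ y ∈ Icc a b, cl y = y := fun y hy => by simp [hcl, projIcc_of_mem hab hy]
  set ρ : ℝ → ℝ := fun y => t (P.index (cl y)) with hρ
  have hρm : ∀ y, ρ y ∈ Icc a b := fun y => (ht _ ⟨cl y, hclm y, rfl⟩).1
  have hρi : ∀ y, P.index (ρ y) = P.index (cl y) := fun y => (ht _ ⟨cl y, hclm y, rfl⟩).2
  -- If `ρ y < ρ x` with `x ≤ y`, then either `cl x` lies between two points of the part of `cl y`,
  -- or `ρ y` lies between two points of the part of `cl x`; convexity of parts identifies the two.
  have hmono : Monotone ρ := by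
    intro x y hxy
    have hxy' : cl x ≤ cl y := monotone_projIcc hab hxy
    by_contra! hlt
    have hne : P.index (cl x) ≠ P.index (cl y) := fun h => by
      simp only [hρ, h, lt_self_iff_false] at hlt
    have ox := P.ordConnected_index (P.index (cl x))
    have oy := P.ordConnected_index (P.index (cl y))
    rcases lt_or_ge (ρ y) (cl x) with h | h
    · exact hne (oy.out (hρi y) rfl ⟨h.le, hxy'⟩)
    · exact hne ((ox.out rfl (hρi x) ⟨h, hlt.le⟩).symm.trans (hρi y))
  have hfin : (range ρ).Finite := (finite_range t).subset (by rintro _ ⟨y, rfl⟩; exact ⟨_, rfl⟩)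
  set T := hfin.toFinset with hT
  have hmem : ∀ y, ρ y ∈ T := fun y => hfin.mem_toFinset.2 ⟨y, rfl⟩
  let e := T.orderIsoOfFin rfl
  refine ⟨T.card, ?_, fun y => e.symm ⟨ρ y, hmem y⟩, fun x y hxy => ?_, fun i => ?_,
    fun i => P.index (e i), fun y hy => ?_⟩
  · calc T.card ≤ (Finset.univ.image t).card := Finset.card_le_card fun x hx => by
          obtain ⟨y, rfl⟩ := hfin.mem_toFinset.1 hx
          exact Finset.mem_image_of_mem _ (Finset.mem_univ _)
      _ ≤ _ := Finset.card_image_le.trans (by simp)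
  · exact e.symm.monotone (Subtype.mk_le_mk.2 (hmono hxy))
  · obtain ⟨y, hy⟩ := hfin.mem_toFinset.1 (e i).2
    refine ⟨ρ y, hρm y, ?_⟩
    have h2 : ρ (ρ y) = ρ y := by
      simp only [hρ] at hρi ⊢
      rw [hcle _ (hρm y), hρi]
    rw [OrderIso.symm_apply_eq]
    exact Subtype.ext (h2.trans hy)
  · simp only [OrderIso.apply_symm_apply]
    rw [hρi, hcle y hy]

section approximation

variable {μ : Measure (ℝ × ℝ)} [IsProbabilityMeasure μ] {L : Range}

theorem ae_mem_of_measure_toSet_eq_one (hμ : μ L.toSet = 1) : ∀ᵐ z ∂μ, z ∈ L.toSet := by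
  have hm : MeasurableSet L.toSet := measurableSet_Icc.prod measurableSet_Icc
  exact (prob_compl_eq_zero_iff hm).2 hμ

theorem lawMatrix_congr_on (hμ : μ L.toSet = 1) {r s : ℕ} {F F' : ℝ → Fin r} {H H' : ℝ → Fin s}
    (hF : ∀ y ∈ Icc L.y₀ L.y₁, F y = F' y) (hH : ∀ x ∈ Icc L.x₀ L.x₁, H x = H' x) :
    lawMatrix μ F H = lawMatrix μ F' H' := by
  funext i j
  refine measureReal_congr ?_
  filter_upwards [ae_mem_of_measure_toSet_eq_one hμ] with z hz
  have : (F z.2 = i ∧ H z.1 = j) = (F' z.2 = i ∧ H' z.1 = j) := by rw [hF _ hz.2, hH _ hz.1]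
  exact this

/-- Dominated convergence: the indicators of the cells are eventually constant at almost every
point. -/
theorem tendsto_lawMatrix (hμ : μ L.toSet = 1) {r s : ℕ} {F : ℝ → Fin r} {H : ℝ → Fin s}
    {F' : ℕ → ℝ → Fin r} {H' : ℕ → ℝ → Fin s} (hFm : Measurable F) (hHm : Measurable H)
    (hFm' : ∀ m, Measurable (F' m)) (hHm' : ∀ m, Measurable (H' m))
    (hF : ∀ y ∈ Icc L.y₀ L.y₁, ∀ᶠ m in atTop, F' m y = F y)
    (hH : ∀ x ∈ Icc L.x₀ L.x₁, ∀ᶠ m in atTop, H' m x = H x) (i : Fin r) (j : Fin s) :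
    Tendsto (fun m => lawMatrix μ (F' m) (H' m) i j) atTop (𝓝 (lawMatrix μ F H i j)) := by
  refine (ENNReal.tendsto_toReal (measure_ne_top _ _)).comp
    (tendsto_measure_of_ae_tendsto_indicator_of_isFiniteMeasure atTop
      (measurableSet_cell hFm hHm i j) (fun m => measurableSet_cell (hFm' m) (hHm' m) i j) ?_)
  filter_upwards [ae_mem_of_measure_toSet_eq_one hμ] with z hz
  filter_upwards [hF _ hz.2, hH _ hz.1] with m h1 h2
  simp [h1, h2]

/-- Along any sequence of master grids that refine both axes, the mutual information of a grid given
by monotone maps is the limit of the mutual informations of subgrids. -/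
theorem exists_tendsto_mutualInfo_push (hμ : μ L.toSet = 1) {k l : ℕ} {F : ℝ → Fin k}
    {H : ℝ → Fin l} (hF : Monotone F) (hH : Monotone H)
    (hF' : ∀ i, ∃ y ∈ Icc L.y₀ L.y₁, F y = i) (hH' : ∀ i, ∃ x ∈ Icc L.x₀ L.x₁, H x = i)
    {r s : ℕ → ℕ} (hr : Tendsto r atTop atTop) (hs : Tendsto s atTop atTop)
    (hr0 : ∀ m, 0 < r m) (hs0 : ∀ m, 0 < s m) :
    ∃ (g : ∀ m, Fin (r m) → Fin k) (h : ∀ m, Fin (s m) → Fin l),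
      (∀ᶠ m in atTop, (Monotone (g m) ∧ Function.Surjective (g m)) ∧
        Monotone (h m) ∧ Function.Surjective (h m)) ∧
      Tendsto (fun m => mutualInfo (pushMatrix (g m) (h m) (masterLaw μ L (hr0 m) (hs0 m)))) atTop
        (𝓝 (mutualInfo (lawMatrix μ F H))) := by
  obtain ⟨g, hg, hgF⟩ := exists_cellIdx_approx L.y_lt hF
  obtain ⟨h, hh, hhH⟩ := exists_cellIdx_approx L.x_lt hH
  have hgF' : ∀ y ∈ Icc L.y₀ L.y₁, ∀ᶠ m in atTop, g (r m) (cellIdx L.y₀ L.y₁ (hr0 m) y) = F y :=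
    fun y hy => (hr.eventually (hgF y hy)).mono fun m hm => hm _
  have hhH' : ∀ x ∈ Icc L.x₀ L.x₁, ∀ᶠ m in atTop, h (s m) (cellIdx L.x₀ L.x₁ (hs0 m) x) = H x :=
    fun x hx => (hs.eventually (hhH x hx)).mono fun m hm => hm _
  refine ⟨fun m => g (r m), fun m => h (s m), ?_, ?_⟩
  · have e1 : ∀ᶠ m in atTop, Function.Surjective (g (r m)) := by
      refine (eventually_all.2 fun i => ?_ :
        ∀ᶠ m in atTop, ∀ i : Fin k, ∃ a, g (r m) a = i)
      obtain ⟨y, hy, rfl⟩ := hF' i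
      exact (hgF' y hy).mono fun m hm => ⟨_, hm⟩
    have e2 : ∀ᶠ m in atTop, Function.Surjective (h (s m)) := by
      refine (eventually_all.2 fun i => ?_ :
        ∀ᶠ m in atTop, ∀ i : Fin l, ∃ a, h (s m) a = i)
      obtain ⟨x, hx, rfl⟩ := hH' i
      exact (hhH' x hx).mono fun m hm => ⟨_, hm⟩
    filter_upwards [e1, e2] with m h1 h2 using ⟨⟨hg _, h1⟩, hh _, h2⟩
  · simp_rw [masterLaw, fun m => (lawMatrix_comp (μ := μ) (measurable_cellIdx_y L (hr0 m))
      (measurable_cellIdx_x L (hs0 m)) (g (r m)) (h (s m))).symm]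
    refine tendsto_mutualInfo (fun _ _ _ => lawMatrix_nonneg _ _) (fun _ _ => lawMatrix_nonneg _ _)
      (tendsto_lawMatrix hμ (measurable_of_monotone_fin hF) (measurable_of_monotone_fin hH)
        (fun m => measurable_of_monotone_fin ((hg _).comp (cellIdx_monotone L.y_lt _)))
        (fun m => measurable_of_monotone_fin ((hh _).comp (cellIdx_monotone L.x_lt _))) hgF' hhH')

theorem masterRows_pos {c : ℝ} (hc : 0 < c) {k l : ℕ} (hk : 0 < k) (hl : 0 < l) :
    0 < masterRows c k l := by
  unfold masterRows
  split_ifs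
  · exact Nat.ceil_pos.2 (mul_pos hc (by exact_mod_cast hl))
  · exact hk

theorem masterCols_pos {c : ℝ} (hc : 0 < c) {k l : ℕ} (hk : 0 < k) (hl : 0 < l) :
    0 < masterCols c k l := by
  unfold masterCols
  split_ifs
  · exact hl
  · exact Nat.ceil_pos.2 (mul_pos hc (by exact_mod_cast hk))

theorem tendsto_ceil_mul_add {c : ℝ} (hc : 0 < c) (N : ℕ) :
    Tendsto (fun m : ℕ => ⌈c * ((m + N : ℕ) : ℝ)⌉₊) atTop atTop :=
  tendsto_nat_ceil_atTop.comp ((tendsto_natCast_atTop_atTop.comp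
    (tendsto_add_atTop_nat N)).const_mul_atTop hc)

/-- The mutual information of a grid given by monotone maps is approximated by subgrids of master
grids whose smaller side is that of the given grid. -/
theorem exists_subGrid_mutualInfo_gt (hμ : μ L.toSet = 1) {c : ℝ} (hc : 0 < c) {k l : ℕ}
    (hk : 2 ≤ k) (hl : 2 ≤ l) {F : ℝ → Fin k} {H : ℝ → Fin l} (hF : Monotone F) (hH : Monotone H)
    (hF' : ∀ i, ∃ y ∈ Icc L.y₀ L.y₁, F y = i) (hH' : ∀ i, ∃ x ∈ Icc L.x₀ L.x₁, H x = i)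
    {θ : ℝ} (hθ : θ < mutualInfo (lawMatrix μ F H)) :
    ∃ (k' l' : ℕ) (hk' : 2 ≤ k') (hl' : 2 ≤ l') (G : SubGrid c k' l'), min k' l' = min k l ∧
      θ < mutualInfo (pushMatrix G.1.1 G.2.1 (masterLaw μ L
        (masterRows_pos hc (two_pos.trans_le hk') (two_pos.trans_le hl'))
        (masterCols_pos hc (two_pos.trans_le hk') (two_pos.trans_le hl')))) := by
  rcases le_or_gt k l with hkl | hkl
  -- Target sizes `(k, m + k)`: the smaller side stays `k` while both axes of the master grid are
  -- refined without bound, however small `c` is.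
  · have hr : ∀ m, masterRows c k (m + k) = ⌈c * ((m + k : ℕ) : ℝ)⌉₊ := fun m => if_pos (by omega)
    have hs : ∀ m, masterCols c k (m + k) = m + k := fun m => if_pos (by omega)
    obtain ⟨g, h, hev, hlim⟩ := exists_tendsto_mutualInfo_push hμ hF hH hF' hH'
      (r := fun m => masterRows c k (m + k)) (s := fun m => masterCols c k (m + k))
      ((tendsto_ceil_mul_add hc k).congr fun m => (hr m).symm)
      ((tendsto_add_atTop_nat k).congr fun m => (hs m).symm)
      (fun m => masterRows_pos hc (by omega) (by omega))
      (fun m => masterCols_pos hc (by omega) (by omega))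
    obtain ⟨m, ⟨⟨hg, hgs⟩, -⟩, hm⟩ := (hev.and (hlim.eventually_const_lt hθ)).exists
    refine ⟨k, m + k, hk, by omega, ⟨⟨g m, hg, hgs⟩, ⟨Fin.cast (hs m),
      (Fin.cast_strictMono (hs m)).monotone, fun i => ⟨Fin.cast (hs m).symm i, rfl⟩⟩⟩,
      by omega, hm.trans_le ?_⟩
    -- Merging the columns further by `h m` yields the approximant of the given grid, so the
    -- unmerged columns carry at least as much information.
    have := mutualInfo_pushMatrix_le id (h m ∘ Fin.cast (hs m).symm) (pushMatrix_nonneg (g m)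
      (Fin.cast (hs m)) (masterLaw_nonneg μ L (masterRows_pos hc (by omega) (by omega))
        (masterCols_pos hc (by omega) (by omega))))
    rwa [pushMatrix_pushMatrix] at this
  · have hr : ∀ m, masterRows c (m + k) l = m + k := fun m => if_neg (by omega)
    have hs : ∀ m, masterCols c (m + k) l = ⌈c * ((m + k : ℕ) : ℝ)⌉₊ := fun m => if_neg (by omega)
    obtain ⟨g, h, hev, hlim⟩ := exists_tendsto_mutualInfo_push hμ hF hH hF' hH'
      (r := fun m => masterRows c (m + k) l) (s := fun m => masterCols c (m + k) l)
      ((tendsto_add_atTop_nat k).congr fun m => (hr m).symm)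
      ((tendsto_ceil_mul_add hc k).congr fun m => (hs m).symm)
      (fun m => masterRows_pos hc (by omega) (by omega))
      (fun m => masterCols_pos hc (by omega) (by omega))
    obtain ⟨m, ⟨-, hh, hhs⟩, hm⟩ := (hev.and (hlim.eventually_const_lt hθ)).exists
    refine ⟨m + k, l, by omega, hl, ⟨⟨Fin.cast (hr m),
      (Fin.cast_strictMono (hr m)).monotone, fun i => ⟨Fin.cast (hr m).symm i, rfl⟩⟩,
      ⟨h m, hh, hhs⟩⟩, by omega, hm.trans_le ?_⟩
    have := mutualInfo_pushMatrix_le (g m ∘ Fin.cast (hr m).symm) id (pushMatrix_nonneg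
      (Fin.cast (hr m)) (h m) (masterLaw_nonneg μ L (masterRows_pos hc (by omega) (by omega))
        (masterCols_pos hc (by omega) (by omega))))
    rwa [pushMatrix_pushMatrix] at this

/-- The normalized mutual information of any grid is approximated by subgrids of master grids. -/
theorem exists_subGrid_normMutualInfo_gt (hμ : μ L.toSet = 1) {c : ℝ} (hc : 0 < c) {k l : ℕ}
    (hk : 2 ≤ k) (hl : 2 ≤ l) (G : Grid k l) {θ : ℝ} (h0 : 0 ≤ θ)
    (hθ : θ < normMutualInfo (gridProb μ G)) :
    ∃ (k' l' : ℕ) (hk' : 2 ≤ k') (hl' : 2 ≤ l') (G' : SubGrid c k' l'),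
      θ < normMutualInfo (pushMatrix G'.1.1 G'.2.1 (masterLaw μ L
        (masterRows_pos hc (two_pos.trans_le hk') (two_pos.trans_le hl'))
        (masterCols_pos hc (two_pos.trans_le hk') (two_pos.trans_le hl')))) := by
  obtain ⟨k₁, hk₁, F, hF, hF', u, hu⟩ := G.rows.exists_monotone L.y_lt.le
  obtain ⟨l₁, hl₁, H, hH, hH', v, hv⟩ := G.cols.exists_monotone L.x_lt.le
  have hFm := measurable_of_monotone_fin hF
  have hHm := measurable_of_monotone_fin hH
  have hlog : ∀ {n : ℕ}, 2 ≤ n → 0 < Real.logb 2 (n : ℝ) := fun hn =>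
    Real.logb_pos (by norm_num) (by exact_mod_cast (by omega : 1 < _))
  have hle : mutualInfo (gridProb μ G) ≤ mutualInfo (lawMatrix μ F H) := by
    rw [gridProb_eq_lawMatrix, ← lawMatrix_congr_on hμ hu hv,
      show (fun y => u (F y)) = u ∘ F from rfl, show (fun x => v (H x)) = v ∘ H from rfl,
      lawMatrix_comp hFm hHm]
    exact mutualInfo_pushMatrix_le _ _ fun _ _ => lawMatrix_nonneg _ _
  have hlt : θ * Real.logb 2 ((min k l : ℕ) : ℝ) < mutualInfo (lawMatrix μ F H) :=
    ((lt_div_iff₀ (hlog (le_min hk hl))).1 hθ).trans_le hle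
  have hpos : 0 < mutualInfo (lawMatrix μ F H) :=
    (mul_nonneg h0 (hlog (le_min hk hl)).le).trans_lt hlt
  -- Discarding the parts that miss `L` may shrink the grid, but positive information still forces
  -- both sides to be at least 2. The smaller grid has a smaller normalizer, which only helps.
  have hmin : 2 ≤ min k₁ l₁ := by
    by_contra hlt2
    have h := mutualInfo_le_logb_min (fun _ _ => lawMatrix_nonneg _ _)
      (sum_lawMatrix (μ := μ) hFm hHm)
    have h01 : min k₁ l₁ = 0 ∨ min k₁ l₁ = 1 := by omega
    rcases h01 with h01 | h01 <;> rw [h01] at h <;> norm_num at h <;> linarith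
  have hmono : Real.logb 2 ((min k₁ l₁ : ℕ) : ℝ) ≤ Real.logb 2 ((min k l : ℕ) : ℝ) :=
    Real.logb_le_logb_of_le (by norm_num) (by exact_mod_cast (by omega : 0 < min k₁ l₁))
      (by exact_mod_cast min_le_min hk₁ hl₁)
  obtain ⟨k', l', hk', hl', G', hmin', hG'⟩ := exists_subGrid_mutualInfo_gt hμ hc
    (le_min_iff.1 hmin).1 (le_min_iff.1 hmin).2 hF hH hF' hH'
    ((mul_le_mul_of_nonneg_left hmono h0).trans_lt hlt)
  refine ⟨k', l', hk', hl', G', ?_⟩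
  rw [normMutualInfo, hmin', lt_div_iff₀ (hlog hmin)]
  exact hG'

end approximation

/-! ### Concentration of empirical cell frequencies -/

section empirical

variable {Ω κ : Type*} [MeasurableSpace Ω] [Fintype κ] [DecidableEq κ]
  [MeasurableSpace κ] [MeasurableSingletonClass κ]

/-- The number of points of `D` that `φ` maps to `c`. -/
def cellCount {n : ℕ} (φ : Ω → κ) (D : Fin n → Ω) (c : κ) : ℕ :=
  (Finset.univ.filter fun m => φ (D m) = c).card

omit [MeasurableSpace Ω] [MeasurableSpace κ] [MeasurableSingletonClass κ] in
theorem sum_mul_cellCount {n : ℕ} (φ : Ω → κ) (D : Fin n → Ω) (w : κ → ℝ) :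
    ∑ c, w c * cellCount φ D c = ∑ m, w (φ (D m)) := by
  rw [← Finset.sum_fiberwise (s := Finset.univ) (g := fun m => φ (D m))]
  refine Finset.sum_congr rfl fun c _ => ?_
  rw [Finset.sum_congr rfl fun m hm => by rw [(Finset.mem_filter.1 hm).2], Finset.sum_const,
    nsmul_eq_mul, mul_comm]
  rfl

omit [DecidableEq κ] in
theorem integral_comp_fintype {μ : Measure Ω} [IsProbabilityMeasure μ] {φ : Ω → κ}
    (hφ : Measurable φ) (w : κ → ℝ) : ∫ x, w (φ x) ∂μ = ∑ c, w c * μ.real (φ ⁻¹' {c}) := by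
  have := Measure.isProbabilityMeasure_map (μ := μ) hφ.aemeasurable
  rw [← integral_map (φ := φ) hφ.aemeasurable
    (measurable_of_countable w).aestronglyMeasurable, integral_fintype .of_finite]
  refine Finset.sum_congr rfl fun c _ => ?_
  rw [smul_eq_mul, mul_comm, map_measureReal_apply hφ (measurableSet_singleton c)]

/-- Hoeffding's inequality for a function with values in `[-1, 1]` of i.i.d. points. -/
theorem measureReal_sum_sub_integral_ge_le {μ : Measure Ω} [IsProbabilityMeasure μ] {n : ℕ}
    (hn : 0 < n) {f : Ω → ℝ} (hf : Measurable f) (hf1 : ∀ x, f x ∈ Icc (-1 : ℝ) 1) {δ : ℝ}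
    (hδ : 0 ≤ δ) :
    (Measure.pi fun _ : Fin n => μ).real {D | δ * n ≤ ∑ m, (f (D m) - ∫ x, f x ∂μ)}
      ≤ Real.exp (-(n * δ ^ 2 / 2)) := by
  have hind := ProbabilityTheory.iIndepFun_pi (μ := fun _ : Fin n => μ)
    (X := fun _ x => f x - ∫ x, f x ∂μ) fun _ => (hf.sub_const _).aemeasurable
  have hsub : ∀ m ∈ (Finset.univ : Finset (Fin n)), ProbabilityTheory.HasSubgaussianMGF
      (fun D : Fin n → Ω => f (D m) - ∫ x, f x ∂μ) 1 (Measure.pi fun _ : Fin n => μ) := by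
    intro m _
    have h := ProbabilityTheory.hasSubgaussianMGF_of_mem_Icc (μ := Measure.pi fun _ : Fin n => μ)
      (X := fun D => f (D m)) (a := -1) (b := 1)
      (hf.comp (measurable_pi_apply m)).aemeasurable (ae_of_all _ fun D => hf1 _)
    rw [integral_comp_eval (μ := fun _ : Fin n => μ) hf.aestronglyMeasurable] at h
    convert h using 1
    -- The sub-Gaussian parameter is the squared half-length of `[-1, 1]`, namely 1.
    have : ‖(1 : ℝ) - -1‖₊ = 2 := by ext; norm_num
    rw [this]; norm_num
  refine (ProbabilityTheory.HasSubgaussianMGF.measure_sum_ge_le_of_iIndepFun hind hsub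
    (ε := δ * n) (by positivity)).trans_eq ?_
  congr 1
  have : (n : ℝ) ≠ 0 := by positivity
  simp
  field_simp

/-- The `ℓ¹` deviation of the empirical frequencies of finitely many cells. -/
theorem measure_sum_abs_cellCount_sub_ge_le {μ : Measure Ω} [IsProbabilityMeasure μ] {n : ℕ}
    (hn : 0 < n) {φ : Ω → κ} (hφ : Measurable φ) {δ : ℝ} (hδ : 0 ≤ δ) :
    (Measure.pi fun _ : Fin n => μ)
        {D | δ * n ≤ ∑ c, |(cellCount φ D c : ℝ) - n * μ.real (φ ⁻¹' {c})|}
      ≤ ENNReal.ofReal (2 ^ Fintype.card κ * Real.exp (-(n * δ ^ 2 / 2))) := by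
  -- The ℓ¹ norm is the maximum of the signed sums over all sign patterns, so Hoeffding is applied
  -- to each of the 2^|κ| patterns.
  set w : Finset κ → κ → ℝ := fun S c => if c ∈ S then 1 else -1 with hw
  have hw1 : ∀ S c, w S c ∈ Icc (-1 : ℝ) 1 := fun S c => by
    simp only [hw]; split_ifs <;> norm_num
  have hsub : {D : Fin n → Ω | δ * n ≤ ∑ c, |(cellCount φ D c : ℝ) - n * μ.real (φ ⁻¹' {c})|}
      ⊆ ⋃ S ∈ (Finset.univ : Finset (Finset κ)),
        {D | δ * n ≤ ∑ m, (w S (φ (D m)) - ∫ x, w S (φ x) ∂μ)} := by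
    intro D hD
    simp only [Finset.mem_univ, iUnion_true, mem_iUnion]
    refine ⟨Finset.univ.filter fun c => 0 ≤ (cellCount φ D c : ℝ) - n * μ.real (φ ⁻¹' {c}), ?_⟩
    have hD' : δ * n ≤ ∑ c, |(cellCount φ D c : ℝ) - n * μ.real (φ ⁻¹' {c})| := hD
    refine hD'.trans_eq ?_
    rw [Finset.sum_sub_distrib, ← sum_mul_cellCount φ D, integral_comp_fintype hφ]
    simp only [Finset.sum_const, Finset.card_univ, Fintype.card_fin, nsmul_eq_mul]
    rw [Finset.mul_sum, ← Finset.sum_sub_distrib]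
    refine Finset.sum_congr rfl fun c _ => ?_
    simp only [hw, Finset.mem_filter, Finset.mem_univ, true_and]
    split_ifs with h
    · rw [abs_of_nonneg h]; ring
    · rw [abs_of_neg (not_le.1 h)]; ring
  refine (measure_mono hsub).trans ((measure_biUnion_finset_le _ _).trans ?_)
  have hb : ∀ S ∈ (Finset.univ : Finset (Finset κ)), (Measure.pi fun _ : Fin n => μ)
      {D | δ * n ≤ ∑ m, (w S (φ (D m)) - ∫ x, w S (φ x) ∂μ)}
      ≤ ENNReal.ofReal (Real.exp (-(n * δ ^ 2 / 2))) := fun S _ => by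
    rw [← ofReal_measureReal]
    exact ENNReal.ofReal_le_ofReal (measureReal_sum_sub_integral_ge_le hn
      ((measurable_of_countable (w S)).comp hφ) (fun x => hw1 S _) hδ)
  refine (Finset.sum_le_sum hb).trans_eq ?_
  rw [Finset.sum_const, Finset.card_univ, Fintype.card_finset, nsmul_eq_mul,
    ENNReal.ofReal_mul (by positivity), ENNReal.ofReal_pow (by norm_num)]
  simp

end empirical

theorem countMatrix_eq_cellCount (L : Range) {r s : ℕ} (hr : 0 < r) (hs : 0 < s) {n : ℕ}
    {D : Fin n → ℝ × ℝ} (hD : ∀ m, D m ∈ L.toSet) (i : Fin r) (j : Fin s) :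
    countMatrix L r s D i j = cellCount (fun z : ℝ × ℝ =>
      (cellIdx L.y₀ L.y₁ hr z.2, cellIdx L.x₀ L.x₁ hs z.1)) D (i, j) := by
  have : Nat.card {m : Fin n // (cellIdx L.y₀ L.y₁ hr (D m).2, cellIdx L.x₀ L.x₁ hs (D m).1)
      = (i, j)} = cellCount (fun z : ℝ × ℝ =>
      (cellIdx L.y₀ L.y₁ hr z.2, cellIdx L.x₀ L.x₁ hs z.1)) D (i, j) := by
    rw [Nat.card_eq_fintype_card, Fintype.card_subtype]; rfl
  rw [← this, countMatrix]
  refine Nat.card_congr (Equiv.subtypeEquivRight fun m => ?_)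
  rw [mem_rangePart_iff L.x_lt hs (hD m).1, mem_rangePart_iff L.y_lt hr (hD m).2, Prod.mk.injEq,
    and_comm]

theorem sum_countMatrix (L : Range) {r s : ℕ} (hr : 0 < r) (hs : 0 < s) {n : ℕ}
    {D : Fin n → ℝ × ℝ} (hD : ∀ m, D m ∈ L.toSet) :
    ∑ i, ∑ j, (countMatrix L r s D i j : ℝ) = n := by
  simp_rw [countMatrix_eq_cellCount L hr hs hD]
  rw [← Fintype.sum_prod_type fun c => (cellCount (fun z : ℝ × ℝ =>
      (cellIdx L.y₀ L.y₁ hr z.2, cellIdx L.x₀ L.x₁ hs z.1)) D c : ℝ)]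
  have := sum_mul_cellCount (fun z : ℝ × ℝ =>
      (cellIdx L.y₀ L.y₁ hr z.2, cellIdx L.x₀ L.x₁ hs z.1)) D fun _ => 1
  simpa using this

/-- The `ℓ¹` deviation of the counts on a master grid from their expectations. -/
theorem measure_sum_abs_countMatrix_sub_ge_le {μ : Measure (ℝ × ℝ)} [IsProbabilityMeasure μ]
    (L : Range) {r s : ℕ} (hr : 0 < r) (hs : 0 < s) {n : ℕ} (hn : 0 < n) {δ : ℝ} (hδ : 0 ≤ δ) :
    (Measure.pi fun _ : Fin n => μ) {D | (∀ m, D m ∈ L.toSet) ∧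
        δ * n ≤ ∑ i, ∑ j, |(countMatrix L r s D i j : ℝ) - n * masterLaw μ L hr hs i j|}
      ≤ ENNReal.ofReal (2 ^ (r * s) * Real.exp (-(n * δ ^ 2 / 2))) := by
  have h := measure_sum_abs_cellCount_sub_ge_le (μ := μ) hn
    (measurable_pair (measurable_cellIdx_y L hr) (measurable_cellIdx_x L hs)) hδ
  rw [Fintype.card_prod, Fintype.card_fin, Fintype.card_fin] at h
  refine (measure_mono fun D hD => ?_).trans h
  refine hD.2.trans_eq ?_
  rw [Fintype.sum_prod_type]
  refine Finset.sum_congr rfl fun i _ => Finset.sum_congr rfl fun j _ => ?_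
  rw [countMatrix_eq_cellCount L hr hs hD.1, masterLaw, lawMatrix]
  congr 4
  ext z
  simp

/-! ### Concentration of the noise -/

theorem lintegral_pi_prod {ι : Type*} [Fintype ι] {E : ι → Type*} [∀ i, MeasurableSpace (E i)]
    (ν : ∀ i, Measure (E i)) [∀ i, IsProbabilityMeasure (ν i)] {f : ∀ i, E i → ENNReal}
    (hf : ∀ i, Measurable (f i)) :
    ∫⁻ x, ∏ i, f i (x i) ∂Measure.pi ν = ∏ i, ∫⁻ y, f i y ∂ν i := by
  refine (ProbabilityTheory.lintegral_prod_eq_prod_lintegral_of_indepFun Finset.univ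
    (fun i (x : ∀ i, E i) => f i (x i))
    (ProbabilityTheory.iIndepFun_pi fun i => (hf i).aemeasurable)
    fun i => (hf i).comp (measurable_pi_apply i)).trans ?_
  refine Finset.prod_congr rfl fun i _ => ?_
  rw [← lintegral_map (hf i) (measurable_pi_apply i), (measurePreserving_eval ν i).map_eq]

/-- The atoms at 0 and n that absorb the tails still obey the geometric decay, so truncation does
not affect the concentration. -/
theorem truncGeomWeight_le {ε : ℝ} (hε : 0 < ε) {n f i : ℕ} (hf : f ≤ n) :
    truncGeomWeight ε n f i ≤ Real.exp (-ε) ^ ((f : ℤ) - i).natAbs := by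
  have h1 : Real.exp (-ε) ≤ 1 := Real.exp_le_one_iff.2 (by linarith)
  have h0 := Real.exp_pos (-ε)
  have hdiv : ∀ m : ℕ, Real.exp (-ε) ^ m / (1 + Real.exp (-ε)) ≤ Real.exp (-ε) ^ m := fun m =>
    div_le_self (by positivity) (by linarith)
  unfold truncGeomWeight
  split_ifs with hi hi' hi''
  · rw [hi, show ((f : ℤ) - (0 : ℕ)).natAbs = f by simp]
    exact hdiv f
  · refine mul_le_of_le_one_left (by positivity) ?_
    rw [div_le_one (by positivity)]
    linarith
  · rw [show ((f : ℤ) - i).natAbs = n - f by omega]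
    exact hdiv _
  · positivity

theorem sum_pow_natAbs_sub_le {σ : ℝ} (h0 : 0 < σ) (h1 : σ < 1) {n f : ℕ} (hf : f ≤ n) :
    ∑ i ∈ Finset.range (n + 1), σ ^ ((f : ℤ) - i).natAbs ≤ 2 / (1 - σ) := by
  -- Used with `m = n`, so that the shifted range covers 1, …, n; the term at 0 is added separately.
  have h := truncGeom_middle_sum σ n f (by omega)
  rw [← Finset.mul_sum] at h
  rw [Finset.sum_range_succ', le_div_iff₀ (by linarith), add_mul, mul_comm _ (1 - σ), h,
    show ((f : ℤ) - (0 : ℕ)).natAbs = f by simp]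
  have hf0 := pow_pos h0 f
  have hf1 := pow_pos h0 (n + 1 - f)
  nlinarith

/-- An exponential moment of the truncated geometric noise. -/
theorem lintegral_exp_truncGeom_le {ε : ℝ} (hε : 0 < ε) {n f : ℕ} (hf : f ≤ n) :
    ∫⁻ i, ENNReal.ofReal (Real.exp (ε / 2 * |(i : ℝ) - f|)) ∂truncGeom ε n f
      ≤ ENNReal.ofReal (2 / (1 - Real.exp (-(ε / 2)))) := by
  have h1 : Real.exp (-(ε / 2)) < 1 := Real.exp_lt_one_iff.2 (by linarith)
  simp only [truncGeom, lintegral_finsetSum_measure, lintegral_smul_measure, lintegral_dirac,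
    smul_eq_mul]
  simp_rw [← ENNReal.ofReal_mul (truncGeomWeight_nonneg hε _ _ _)]
  rw [← ENNReal.ofReal_sum_of_nonneg fun i _ =>
    mul_nonneg (truncGeomWeight_nonneg hε _ _ _) (Real.exp_pos _).le]
  refine ENNReal.ofReal_le_ofReal ((Finset.sum_le_sum fun i _ => ?_).trans
    (sum_pow_natAbs_sub_le (Real.exp_pos _) h1 hf))
  -- Half of the decay rate pays for the exponential; the other half keeps the sum finite uniformly
  -- in `n` and `f`.
  refine (mul_le_mul_of_nonneg_right (truncGeomWeight_le hε hf) (Real.exp_pos _).le).trans_eq ?_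
  have : |(i : ℝ) - f| = (((f : ℤ) - i).natAbs : ℝ) := by
    rw [Nat.cast_natAbs, abs_sub_comm]
    push_cast
    rfl
  rw [this, ← Real.exp_nat_mul, ← Real.exp_nat_mul, ← Real.exp_add]
  congr 1
  ring

/-- The `ℓ¹` size of the noise on a master grid. -/
theorem noisyCountLaw_sum_abs_sub_ge_le (L : Range) (c : ℝ) {ε : ℝ} (hε : 0 < ε) {n : ℕ}
    (hn : 0 < n) (D : Fin n → ℝ × ℝ) (k l : ℕ) (t : ℝ) :
    noisyCountLaw L c ε D k l {A | t ≤ ∑ i, ∑ j,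
        |(A i j : ℝ) - countMatrix L (masterRows c k l) (masterCols c k l) D i j|}
      ≤ ENNReal.ofReal ((2 / (1 - Real.exp (-(ε / 4)))) ^ (masterRows c k l * masterCols c k l)
        * Real.exp (-(ε / 4 * t))) := by
  set a := countMatrix L (masterRows c k l) (masterCols c k l) D with ha
  have hle : ∀ i j, a i j ≤ n := countMatrix_le L _ _ D
  have hprob := fun i j => isProbabilityMeasure_truncGeom (half_pos hε) hn (hle i j)
  have hC : 0 ≤ 2 / (1 - Real.exp (-(ε / 4))) :=
    div_nonneg zero_le_two (sub_nonneg.2 (Real.exp_le_one_iff.2 (by linarith)))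
  -- Chernoff's method: the exponential moment of the total noise factors over the independent
  -- cells, and Markov's inequality concludes.
  have hint : ∫⁻ A, ENNReal.ofReal (Real.exp (ε / 4 * ∑ i, ∑ j, |(A i j : ℝ) - a i j|))
      ∂noisyCountLaw L c ε D k l
      ≤ ENNReal.ofReal (2 / (1 - Real.exp (-(ε / 4))))
        ^ (masterRows c k l * masterCols c k l) := by
    have he : ∀ A : Fin (masterRows c k l) → Fin (masterCols c k l) → ℕ,
        ENNReal.ofReal (Real.exp (ε / 4 * ∑ i, ∑ j, |(A i j : ℝ) - a i j|))
        = ∏ i, ∏ j, ENNReal.ofReal (Real.exp (ε / 2 / 2 * |(A i j : ℝ) - a i j|)) := by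
      intro A
      simp_rw [Finset.mul_sum, Real.exp_sum, show ε / 2 / 2 = ε / 4 by ring]
      rw [ENNReal.ofReal_prod_of_nonneg fun i _ =>
        Finset.prod_nonneg fun j _ => (Real.exp_pos _).le]
      exact Finset.prod_congr rfl fun i _ =>
        ENNReal.ofReal_prod_of_nonneg fun j _ => (Real.exp_pos _).le
    simp_rw [he, noisyCountLaw]
    rw [lintegral_pi_prod _ (f := fun i (row : Fin (masterCols c k l) → ℕ) =>
      ∏ j, ENNReal.ofReal (Real.exp (ε / 2 / 2 * |(row j : ℝ) - a i j|)))
      fun i => measurable_of_countable _]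
    have hrow : ∀ i, ∫⁻ row : Fin (masterCols c k l) → ℕ,
        ∏ j, ENNReal.ofReal (Real.exp (ε / 2 / 2 * |(row j : ℝ) - a i j|))
          ∂(Measure.pi fun j => truncGeom (ε / 2) n (a i j))
        ≤ ENNReal.ofReal (2 / (1 - Real.exp (-(ε / 4)))) ^ masterCols c k l := by
      intro i
      rw [lintegral_pi_prod _ (f := fun j (x : ℕ) =>
        ENNReal.ofReal (Real.exp (ε / 2 / 2 * |(x : ℝ) - a i j|)))
        fun j => measurable_of_countable _]
      refine (Finset.prod_le_prod' fun j _ =>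
        lintegral_exp_truncGeom_le (half_pos hε) (hle i j)).trans_eq ?_
      rw [Finset.prod_const, Finset.card_univ, Fintype.card_fin, show ε / 2 / 2 = ε / 4 by ring]
    refine (Finset.prod_le_prod' fun i _ => hrow i).trans_eq ?_
    rw [Finset.prod_const, Finset.card_univ, Fintype.card_fin, ← pow_mul, mul_comm]
  have hmarkov := meas_ge_le_lintegral_div (μ := noisyCountLaw L c ε D k l)
    (f := fun A => ENNReal.ofReal (Real.exp (ε / 4 * ∑ i, ∑ j, |(A i j : ℝ) - a i j|)))
    (measurable_of_countable _).aemeasurable (ε := ENNReal.ofReal (Real.exp (ε / 4 * t)))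
    (ENNReal.ofReal_pos.2 (Real.exp_pos _)).ne' ENNReal.ofReal_ne_top
  refine (measure_mono fun A hA => ?_).trans (hmarkov.trans
    ((ENNReal.div_le_div_right hint _).trans_eq ?_))
  · exact ENNReal.ofReal_le_ofReal (Real.exp_le_exp.2
      (mul_le_mul_of_nonneg_left hA (by positivity)))
  · rw [ENNReal.ofReal_mul (by positivity), ENNReal.ofReal_pow hC, Real.exp_neg (ε / 4 * t),
      ENNReal.ofReal_inv_of_pos (Real.exp_pos _), ENNReal.div_eq_inv_mul, mul_comm]

/-- The effect of the noise and of the normalization on the matrix of frequencies. -/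
theorem sum_abs_normalize_sub_le {r s n : ℕ} (hn : 0 < n) (A : Fin r → Fin s → ℕ)
    {a p : Fin r → Fin s → ℝ} (ha : ∑ i, ∑ j, a i j = n) :
    ∑ i, ∑ j, |normalize A i j - p i j| ≤
      2 * (∑ i, ∑ j, |(A i j : ℝ) - a i j|) / n + (∑ i, ∑ j, |a i j - n * p i j|) / n := by
  have hn' : (0 : ℝ) < n := by exact_mod_cast hn
  set S := ∑ i, ∑ j, |(A i j : ℝ) - a i j| with hS
  set N : ℝ := ∑ i, ∑ j, (A i j : ℝ) with hN
  have hNcast : ((∑ i', ∑ j', A i' j' : ℕ) : ℝ) = N := by push_cast; rfl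
  have hN0 : 0 ≤ N := Finset.sum_nonneg fun _ _ => Finset.sum_nonneg fun _ _ => Nat.cast_nonneg _
  have h1 : |N - n| ≤ S := by
    rw [← ha, hN, ← Finset.sum_sub_distrib]
    simp_rw [← Finset.sum_sub_distrib]
    exact (Finset.abs_sum_le_sum_abs _ _).trans
      (Finset.sum_le_sum fun i _ => Finset.abs_sum_le_sum_abs _ _)
  -- Dividing by the noisy total instead of `n` costs at most `|N - n| / n`, a second copy of the
  -- noise; hence the factor 2. If `N = 0`, the left side vanishes.
  have hfirst : ∑ i, ∑ j, |normalize A i j - A i j / n| ≤ S / n := by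
    have he : ∀ i j, |normalize A i j - A i j / n| = A i j * |1 / N - 1 / n| := fun i j => by
      rw [normalize, hNcast, div_eq_mul_one_div, div_eq_mul_one_div (A i j : ℝ) (n : ℝ), ← mul_sub,
        abs_mul, Nat.abs_cast]
    simp_rw [he, ← Finset.sum_mul]
    rcases hN0.eq_or_lt with h | h
    · rw [← hN, ← h, zero_mul]
      exact div_nonneg ((abs_nonneg _).trans h1) hn'.le
    · rw [← hN, ← abs_of_pos h, ← abs_mul, abs_of_pos h, le_div_iff₀ hn', ← abs_of_pos hn',
        ← abs_mul, abs_of_pos hn']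
      have : N * (1 / N - 1 / n) * n = -(N - n) := by field_simp; ring
      rw [this, abs_neg]
      exact h1
  have hdiv : ∀ f : Fin r → Fin s → ℝ, (∑ i, ∑ j, |f i j|) / n = ∑ i, ∑ j, |f i j / n| := by
    intro f
    simp_rw [Finset.sum_div, abs_div, abs_of_pos hn']
  have hsplit : ∀ i j, |normalize A i j - p i j| ≤ |normalize A i j - A i j / n|
      + |((A i j : ℝ) - a i j) / n| + |(a i j - n * p i j) / n| := fun i j => by
    have : normalize A i j - p i j = (normalize A i j - A i j / n)
        + ((A i j : ℝ) - a i j) / n + (a i j - n * p i j) / n := by field_simp; ring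
    rw [this]
    exact abs_add_three _ _ _
  calc ∑ i, ∑ j, |normalize A i j - p i j|
      ≤ ∑ i, ∑ j, (|normalize A i j - A i j / n|
      + |((A i j : ℝ) - a i j) / n| + |(a i j - n * p i j) / n|) :=
        Finset.sum_le_sum fun i _ => Finset.sum_le_sum fun j _ => hsplit i j
    _ = ∑ i, ∑ j, |normalize A i j - A i j / n| + S / n
        + (∑ i, ∑ j, |a i j - n * p i j|) / n := by
        rw [hS, hdiv, hdiv]
        simp_rw [Finset.sum_add_distrib]
    _ ≤ _ := by
        rw [mul_div_assoc]
        linarith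

theorem normalize_nonneg {r s : ℕ} (A : Fin r → Fin s → ℕ) (i : Fin r) (j : Fin s) :
    0 ≤ normalize A i j :=
  div_nonneg (Nat.cast_nonneg _) (Nat.cast_nonneg _)

theorem sum_normalize {r s : ℕ} (A : Fin r → Fin s → ℕ) :
    ∑ i, ∑ j, normalize A i j = 1 ∨ normalize A = 0 := by
  by_cases h : (∑ i, ∑ j, A i j) = 0
  · right
    funext i j
    simp [normalize, h]
  · left
    have h' : ((∑ i, ∑ j, A i j : ℕ) : ℝ) ≠ 0 := by exact_mod_cast h
    simp_rw [normalize, ← Finset.sum_div]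
    rw [div_eq_one_iff_eq h']
    push_cast
    rfl

theorem normMutualInfo_pushMatrix_normalize_nonneg {r s k l : ℕ} (hk : 2 ≤ k) (hl : 2 ≤ l)
    (u : Fin r → Fin k) (v : Fin s → Fin l) (A : Fin r → Fin s → ℕ) :
    0 ≤ normMutualInfo (pushMatrix u v (normalize A)) := by
  rcases sum_normalize A with h | h
  · exact normMutualInfo_nonneg (pushMatrix_nonneg _ _ (normalize_nonneg A))
      ((sum_pushMatrix _ _ _).trans h) hk hl
  · simp [h, normMutualInfo, mutualInfo, pushMatrix]

/-! ### Rates -/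

/-- The exponent is eventually at most n^(2α) (MK² - κ n^(1/2 - α)), where K is the constant in B =
O(n^α). -/
theorem tendsto_exp_sq_sub_rate {α κ M : ℝ} (hα₀ : 0 < α) (hα₁ : α < 1 / 2) (hκ : 0 < κ)
    (hM : 0 ≤ M) {B : ℕ → ℝ} (hB : B =O[atTop] fun n : ℕ => (n : ℝ) ^ α) :
    Tendsto (fun n : ℕ => Real.exp (M * B n ^ 2 - κ * (n * ((n : ℝ) ^ (-(1 / 4 - α / 2))) ^ 2)))
      atTop (𝓝 0) := by
  refine Real.tendsto_exp_atBot.comp ?_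
  obtain ⟨K, hK⟩ := hB.bound
  have h1 : Tendsto (fun n : ℕ => (n : ℝ) ^ (2 * α)) atTop atTop :=
    (tendsto_rpow_atTop (by linarith)).comp tendsto_natCast_atTop_atTop
  have h2 : Tendsto (fun n : ℕ => M * K ^ 2 - κ * (n : ℝ) ^ (1 / 2 - α)) atTop atBot := by
    have := ((tendsto_rpow_atTop (by linarith : 0 < 1 / 2 - α)).comp
      tendsto_natCast_atTop_atTop).const_mul_atTop hκ
    exact tendsto_atBot_add_const_left _ _ (tendsto_neg_atTop_atBot.comp this)
  refine tendsto_atBot_mono' atTop ?_ (h1.atTop_mul_atBot₀ h2)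
  filter_upwards [hK, eventually_gt_atTop 0] with n hn hn0
  have hnr : (0 : ℝ) < n := by exact_mod_cast hn0
  have e1 : (n : ℝ) * ((n : ℝ) ^ (-(1 / 4 - α / 2))) ^ 2
      = (n : ℝ) ^ (2 * α) * (n : ℝ) ^ (1 / 2 - α) := by
    rw [← Real.rpow_natCast, ← Real.rpow_mul hnr.le, ← Real.rpow_add hnr]
    nth_rewrite 1 [← Real.rpow_one (n : ℝ)]
    rw [← Real.rpow_add hnr]
    congr 1
    push_cast
    ring
  have e2 : B n ^ 2 ≤ K ^ 2 * (n : ℝ) ^ (2 * α) := by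
    rw [Real.norm_eq_abs, Real.norm_eq_abs, abs_of_pos (Real.rpow_pos_of_pos hnr α)] at hn
    have := pow_le_pow_left₀ (abs_nonneg _) hn 2
    rw [sq_abs, mul_pow, ← Real.rpow_natCast ((n : ℝ) ^ α), ← Real.rpow_mul hnr.le] at this
    rwa [mul_comm α, Nat.cast_ofNat] at this
  rw [e1]
  have := mul_le_mul_of_nonneg_left e2 hM
  linarith

theorem tendsto_error_rate {α : ℝ} (hα₁ : α < 1 / 2) {B : ℕ → ℝ}
    (hB : B =O[atTop] fun n : ℕ => (n : ℝ) ^ α) :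
    Tendsto (fun n : ℕ => 3 * (3 * (n : ℝ) ^ (-(1 / 4 - α / 2)) * (1 + Real.log n) + B n / n)
      / Real.log 2) atTop (𝓝 0) := by
  have hη : 0 < 1 / 4 - α / 2 := by linarith
  have h1 : Tendsto (fun n : ℕ => (n : ℝ) ^ (-(1 / 4 - α / 2))) atTop (𝓝 0) :=
    (tendsto_rpow_neg_atTop hη).comp tendsto_natCast_atTop_atTop
  have h2 : Tendsto (fun n : ℕ => (n : ℝ) ^ (-(1 / 4 - α / 2)) * Real.log n) atTop (𝓝 0) := by
    have h := (isLittleO_log_rpow_atTop hη).tendsto_div_nhds_zero.comp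
      (tendsto_natCast_atTop_atTop (R := ℝ))
    refine h.congr fun n => ?_
    simp only [Function.comp_apply]
    rw [Real.rpow_neg (Nat.cast_nonneg n), div_eq_inv_mul]
  have h3 : Tendsto (fun n : ℕ => B n / n) atTop (𝓝 0) := by
    have h : (fun n : ℕ => (n : ℝ) ^ α / n) =ᶠ[atTop] fun n : ℕ => (n : ℝ) ^ (-(1 - α)) := by
      filter_upwards [eventually_gt_atTop 0] with n hn
      rw [neg_sub, Real.rpow_sub_one (by exact_mod_cast hn.ne')]
    have hO : (fun n : ℕ => B n / n) =O[atTop] fun n : ℕ => (n : ℝ) ^ (-(1 - α)) :=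
      (hB.mul (isBigO_refl (fun n : ℕ => (n : ℝ)⁻¹) atTop)).trans_eventuallyEq h
    exact hO.trans_tendsto ((tendsto_rpow_neg_atTop (by linarith)).comp
      tendsto_natCast_atTop_atTop)
  have h4 := ((((h1.add h2).const_mul 3).add h3).const_mul 3).div_const (Real.log 2)
  simp only [add_zero, mul_zero, zero_div] at h4
  refine h4.congr fun n => ?_
  ring

/-! ### Grid sizes below a bound -/

open Classical in
/-- The grid sizes `(k, ℓ)` with `k, ℓ ≥ 2` and `k ℓ ≤ B`. -/
def gridSizes (B : ℝ) : Finset (ℕ × ℕ) :=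
  (Finset.range (⌊B⌋₊ + 1) ×ˢ Finset.range (⌊B⌋₊ + 1)).filter fun s =>
    2 ≤ s.1 ∧ 2 ≤ s.2 ∧ ((s.1 * s.2 : ℕ) : ℝ) ≤ B

theorem mem_gridSizes {B : ℝ} {s : ℕ × ℕ} :
    s ∈ gridSizes B ↔ 2 ≤ s.1 ∧ 2 ≤ s.2 ∧ ((s.1 * s.2 : ℕ) : ℝ) ≤ B := by
  simp only [gridSizes, Finset.mem_filter, Finset.mem_product, Finset.mem_range,
    and_iff_right_iff_imp]
  rintro ⟨h1, h2, h3⟩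
  have := Nat.le_floor h3
  constructor <;> nlinarith

/-- Deliberately crude: the number of sizes only has to be absorbed into the factor exp(O(B²))
already caused by the number of cells. -/
theorem card_gridSizes_le {B : ℝ} (hB : 1 ≤ B) :
    ((gridSizes B).card : ℝ) ≤ Real.exp (2 * B ^ 2) := by
  have h1 : (gridSizes B).card ≤ (⌊B⌋₊ + 1) * (⌊B⌋₊ + 1) :=
    (Finset.card_filter_le _ _).trans (by simp)
  have h2 : ((⌊B⌋₊ + 1 : ℕ) : ℝ) ≤ Real.exp (B ^ 2) := by
    have h3 := Nat.floor_le (zero_le_one.trans hB)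
    have h4 := Real.add_one_le_exp (B ^ 2)
    push_cast
    nlinarith
  calc ((gridSizes B).card : ℝ) ≤ ((⌊B⌋₊ + 1 : ℕ) : ℝ) * ((⌊B⌋₊ + 1 : ℕ) : ℝ) := by
        exact_mod_cast h1
    _ ≤ Real.exp (B ^ 2) * Real.exp (B ^ 2) := by gcongr
    _ = _ := by rw [← Real.exp_add]; ring_nf

theorem finite_gridSizes (B : ℝ) :
    Finite {s : ℕ × ℕ // 2 ≤ s.1 ∧ 2 ≤ s.2 ∧ ((s.1 * s.2 : ℕ) : ℝ) ≤ B} :=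
  Finite.of_injective (fun s => (⟨s.1, mem_gridSizes.2 s.2⟩ : gridSizes B))
    fun _ _ h => Subtype.ext (congrArg (fun x : gridSizes B => x.1) h)

theorem masterRows_mul_masterCols_le {c : ℝ} (hc : 0 < c) {B : ℝ} {k l : ℕ} (hk : 2 ≤ k)
    (hl : 2 ≤ l) (h : ((k * l : ℕ) : ℝ) ≤ B) :
    ((masterRows c k l * masterCols c k l : ℕ) : ℝ) ≤ (c + 1) * B ^ 2 := by
  have key : ∀ m : ℕ, 1 ≤ m → (m : ℝ) ≤ B → (⌈c * m⌉₊ : ℝ) * m ≤ (c + 1) * B ^ 2 := by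
    intro m hm hmB
    have hm1 : (1 : ℝ) ≤ m := by exact_mod_cast hm
    have h1 := (Nat.ceil_lt_add_one (show 0 ≤ c * m by positivity)).le
    have h2 : (⌈c * m⌉₊ : ℝ) ≤ (c + 1) * B := by nlinarith
    calc (⌈c * m⌉₊ : ℝ) * m ≤ ((c + 1) * B) * B :=
          mul_le_mul h2 hmB (by positivity) ((Nat.cast_nonneg _).trans h2)
      _ = _ := by ring
  have hkB : (k : ℝ) ≤ B := le_trans (by exact_mod_cast (by nlinarith : k ≤ k * l)) h
  have hlB : (l : ℝ) ≤ B := le_trans (by exact_mod_cast (by nlinarith : l ≤ k * l)) h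
  unfold masterRows masterCols
  split_ifs
  · push_cast
    exact key l (by omega) hlB
  · push_cast
    rw [mul_comm]
    exact key k (by omega) hkB

/-- A union bound over grid sizes, for events with probability exponentially small in `n δ²` and
exponentially large in the number of cells. -/
theorem measure_gridSizes_biUnion_le {Ω : Type*} [MeasurableSpace Ω] (ν : Measure Ω) {c B C κ x : ℝ}
    (hc : 0 < c) (hB : 1 ≤ B) (hC : 1 ≤ C) {S : ℕ × ℕ → Set Ω}
    (hS : ∀ s ∈ gridSizes B, ν (S s) ≤
      ENNReal.ofReal (C ^ (masterRows c s.1 s.2 * masterCols c s.1 s.2) * Real.exp (-(κ * x)))) :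
    ν (⋃ s ∈ gridSizes B, S s) ≤
      ENNReal.ofReal (Real.exp (((c + 1) * Real.log C + 2) * B ^ 2 - κ * x)) := by
  have hC0 : 0 < C := zero_lt_one.trans_le hC
  have hb : ∀ s ∈ gridSizes B, ν (S s) ≤
      ENNReal.ofReal (Real.exp ((c + 1) * B ^ 2 * Real.log C) * Real.exp (-(κ * x))) := by
    intro s hs
    obtain ⟨h1, h2, h3⟩ := mem_gridSizes.1 hs
    refine (hS s hs).trans (ENNReal.ofReal_le_ofReal
      (mul_le_mul_of_nonneg_right ?_ (Real.exp_pos _).le))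
    rw [← Real.rpow_natCast, Real.rpow_def_of_pos hC0, mul_comm (Real.log C)]
    exact Real.exp_le_exp.2 (mul_le_mul_of_nonneg_right
      (masterRows_mul_masterCols_le hc h1 h2 h3) (Real.log_nonneg hC))
  refine (measure_biUnion_finset_le _ _).trans ((Finset.sum_le_sum hb).trans ?_)
  rw [Finset.sum_const, nsmul_eq_mul, ← ENNReal.ofReal_natCast,
    ← ENNReal.ofReal_mul (Nat.cast_nonneg _)]
  refine ENNReal.ofReal_le_ofReal ((mul_le_mul_of_nonneg_right (card_gridSizes_le hB)
    (by positivity)).trans_eq ?_)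
  rw [← Real.exp_add, ← Real.exp_add]
  congr 1
  ring

/-! ### The output on typical samples and noise -/

section output

variable {μ : Measure (ℝ × ℝ)} [IsProbabilityMeasure μ] {L : Range} {c : ℝ}

/-- The ℓ¹ error is at most 3δ: twice the noise plus once the sampling error. The entropy modulus is
then used with `t = 1/n`. -/
theorem abs_normMutualInfo_normalize_sub_le {r s k l n : ℕ} (hr : 0 < r) (hs : 0 < s) (hn : 0 < n)
    {D : Fin n → ℝ × ℝ} (hD : ∀ m, D m ∈ L.toSet) (hk : 2 ≤ k) (hl : 2 ≤ l) {B δ : ℝ}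
    (hB : ((k * l : ℕ) : ℝ) ≤ B) {A : Fin r → Fin s → ℕ}
    (hA : ∑ i, ∑ j, |(A i j : ℝ) - countMatrix L r s D i j| ≤ δ * n)
    (hDμ : ∑ i, ∑ j, |(countMatrix L r s D i j : ℝ) - n * masterLaw μ L hr hs i j| ≤ δ * n)
    (u : Fin r → Fin k) (v : Fin s → Fin l) :
    |normMutualInfo (pushMatrix u v (normalize A))
        - normMutualInfo (pushMatrix u v (masterLaw μ L hr hs))|
      ≤ 3 * (3 * δ * (1 + Real.log n) + B / n) / Real.log 2 := by
  have hn' : (0 : ℝ) < n := by exact_mod_cast hn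
  have hn1 : (1 : ℝ) ≤ n := by exact_mod_cast hn
  have hsum : ∑ i, ∑ j, pushMatrix u v (normalize A) i j ≤ 1 := by
    rw [sum_pushMatrix]
    rcases sum_normalize A with h | h <;> simp [h]
  have hl1 := (sum_abs_pushMatrix_sub_le u v (normalize A) (masterLaw μ L hr hs)).trans
    (sum_abs_normalize_sub_le hn A (p := masterLaw μ L hr hs) (sum_countMatrix L hr hs hD))
  have hl1' : ∑ i, ∑ j, |pushMatrix u v (normalize A) i j
      - pushMatrix u v (masterLaw μ L hr hs) i j| ≤ 3 * δ := by
    refine hl1.trans ?_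
    rw [← add_div, div_le_iff₀ hn']
    linarith
  have h := abs_mutualInfo_sub_le (t := 1 / (n : ℝ)) (by omega) (by omega)
    (pushMatrix_nonneg u v (normalize_nonneg A)) hsum
    (pushMatrix_nonneg u v (masterLaw_nonneg μ L hr hs))
    ((sum_pushMatrix u v _).trans (sum_masterLaw μ L hr hs)).le (by positivity)
    ((div_le_one hn').2 hn1)
  refine (abs_normMutualInfo_sub_le hk hl).trans (h.trans ?_)
  rw [one_div_one_div, mul_one_div]
  have hlog := Real.log_nonneg hn1
  have hlog2 := Real.log_pos (one_lt_two (α := ℝ))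
  push_cast at hB
  gcongr

instance (k l : ℕ) : Finite (SubGrid c k l) := by
  unfold SubGrid Subpartition
  infer_instance

theorem micrGeomOutput_nonneg (B : ℝ) (A : NoisyCounts c) : 0 ≤ micrGeomOutput B c A :=
  Real.iSup_nonneg fun s => Real.iSup_nonneg fun G => by
    rw [mergeMatrix_eq_pushMatrix]
    exact normMutualInfo_pushMatrix_normalize_nonneg s.2.1 s.2.2.1 _ _ _

theorem normMutualInfo_le_micrGeomOutput {B : ℝ} (A : NoisyCounts c) {k l : ℕ} (hk : 2 ≤ k)
    (hl : 2 ≤ l) (hB : ((k * l : ℕ) : ℝ) ≤ B) (G : SubGrid c k l) :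
    normMutualInfo (pushMatrix G.1.1 G.2.1 (normalize (A k l))) ≤ micrGeomOutput B c A := by
  have := finite_gridSizes B
  rw [← mergeMatrix_eq_pushMatrix]
  exact (le_ciSup (f := fun G : SubGrid c k l => normMutualInfo (mergeMatrix (normalize (A k l)) G))
    (finite_range _).bddAbove G).trans
    (le_ciSup (f := fun s : {s : ℕ × ℕ // 2 ≤ s.1 ∧ 2 ≤ s.2 ∧ ((s.1 * s.2 : ℕ) : ℝ) ≤ B} =>
      noisyEntry c s.1.1 s.1.2 (A s.1.1 s.1.2)) (finite_range _).bddAbove ⟨(k, l), hk, hl, hB⟩)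

theorem micrGeomOutput_le (hc : 0 < c) {B ω : ℝ} (hω : 0 ≤ ω) {A : NoisyCounts c}
    (h : ∀ (k l : ℕ) (hk : 2 ≤ k) (hl : 2 ≤ l), ((k * l : ℕ) : ℝ) ≤ B → ∀ G : SubGrid c k l,
      normMutualInfo (pushMatrix G.1.1 G.2.1 (normalize (A k l))) ≤
        normMutualInfo (pushMatrix G.1.1 G.2.1 (masterLaw μ L
        (masterRows_pos hc (two_pos.trans_le hk) (two_pos.trans_le hl))
        (masterCols_pos hc (two_pos.trans_le hk) (two_pos.trans_le hl)))) + ω) :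
    micrGeomOutput B c A ≤ micStar μ + ω := by
  have h0 : 0 ≤ micStar μ + ω := add_nonneg (micStar_nonneg μ) hω
  refine Real.iSup_le (fun s => Real.iSup_le (fun G => ?_) h0) h0
  rw [mergeMatrix_eq_pushMatrix]
  refine (h _ _ s.2.1 s.2.2.1 s.2.2.2 G).trans (add_le_add_left ?_ ω)
  obtain ⟨G', hG'⟩ := exists_grid_gridProb_eq μ L
    (masterRows_pos hc (two_pos.trans_le s.2.1) (two_pos.trans_le s.2.2.1))
    (masterCols_pos hc (two_pos.trans_le s.2.1) (two_pos.trans_le s.2.2.1))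
    G.1.2.1 G.1.2.2 G.2.2.1 G.2.2.2
  rw [← hG']
  exact normMutualInfo_le_micStar μ s.2.1 s.2.2.1 G'

end output

/-! ### Consistency of `MICr-Geom` -/

section consistency

variable {μ : Measure (ℝ × ℝ)} [IsProbabilityMeasure μ] {L : Range} {c : ℝ}

/-- The deviation of the counts on the master grid for `(k, ℓ)` from their expectations. -/
def countDeviation (μ : Measure (ℝ × ℝ)) (L : Range) (hc : 0 < c) {n : ℕ} (D : Fin n → ℝ × ℝ)
    {k l : ℕ} (hk : 2 ≤ k) (hl : 2 ≤ l) : ℝ :=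
  ∑ i, ∑ j, |(countMatrix L (masterRows c k l) (masterCols c k l) D i j : ℝ)
    - n * masterLaw μ L (masterRows_pos hc (two_pos.trans_le hk) (two_pos.trans_le hl))
        (masterCols_pos hc (two_pos.trans_le hk) (two_pos.trans_le hl)) i j|

/-- The deviation of noisy counts on the master grid for `(k, ℓ)` from the true counts. -/
def noiseDeviation (L : Range) {n : ℕ} (D : Fin n → ℝ × ℝ) (A : NoisyCounts c) (k l : ℕ) : ℝ :=
  ∑ i, ∑ j, |(A k l i j : ℝ) - countMatrix L (masterRows c k l) (masterCols c k l) D i j|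

/-- A bound for the probability that the sample or the noise is atypical. -/
def failureBound (c ε B x : ℝ) : ℝ :=
  Real.exp (((c + 1) * Real.log (2 / (1 - Real.exp (-(ε / 4)))) + 2) * B ^ 2
    - min (1 / 2) (ε / 4) * x)

/-- Lets a single base dominate both the sign-pattern factor 2 per cell and the noise moment, so
sample and noise share `failureBound`. -/
theorem two_le_two_div_one_sub_exp {ε : ℝ} (hε : 0 < ε) :
    2 ≤ 2 / (1 - Real.exp (-(ε / 4))) := by
  have h1 : Real.exp (-(ε / 4)) < 1 := Real.exp_lt_one_iff.2 (by linarith)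
  have h0 := Real.exp_pos (-(ε / 4))
  rw [le_div_iff₀ (by linarith)]
  linarith

/-- Samples are atypical with small probability. -/
theorem measure_countDeviation_le (hc : 0 < c) {ε : ℝ} (hε : 0 < ε) {n : ℕ} (hn : 0 < n) {B δ : ℝ}
    (hB : 1 ≤ B) (hδ : 0 ≤ δ) :
    (Measure.pi fun _ : Fin n => μ) {D | (∀ m, D m ∈ L.toSet) ∧
      ∃ (k l : ℕ) (hk : 2 ≤ k) (hl : 2 ≤ l), ((k * l : ℕ) : ℝ) ≤ B ∧
        δ * n ≤ countDeviation μ L hc D hk hl}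
      ≤ ENNReal.ofReal (failureBound c ε B (n * δ ^ 2)) := by
  have hC := two_le_two_div_one_sub_exp hε
  refine (measure_mono ?_).trans (measure_gridSizes_biUnion_le _ hc hB (by linarith)
    (S := fun s => {D | (∀ m, D m ∈ L.toSet) ∧ ∃ (hk : 2 ≤ s.1) (hl : 2 ≤ s.2),
      δ * n ≤ countDeviation μ L hc D hk hl}) ?_)
  · rintro D ⟨hD, k, l, hk, hl, hkl, h⟩
    exact mem_iUnion₂.2 ⟨(k, l), mem_gridSizes.2 ⟨hk, hl, hkl⟩, hD, hk, hl, h⟩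
  · intro s hs
    obtain ⟨hk, hl, -⟩ := mem_gridSizes.1 hs
    refine (measure_mono ?_).trans ((measure_sum_abs_countMatrix_sub_ge_le L
      (masterRows_pos hc (two_pos.trans_le hk) (two_pos.trans_le hl))
      (masterCols_pos hc (two_pos.trans_le hk) (two_pos.trans_le hl)) hn hδ).trans
      (ENNReal.ofReal_le_ofReal ?_))
    · rintro D ⟨hD, _, _, h⟩
      exact ⟨hD, h⟩
    · refine mul_le_mul (pow_le_pow_left₀ zero_le_two hC _) (Real.exp_le_exp.2 ?_)
        (Real.exp_pos _).le (by positivity)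
      have h1 := mul_le_mul_of_nonneg_right (min_le_left (1 / 2) (ε / 4))
        (show 0 ≤ n * δ ^ 2 by positivity)
      linarith

/-- The noise is atypical with small probability. -/
theorem measure_noiseDeviation_le (hc : 0 < c) {ε : ℝ} (hε : 0 < ε) {n : ℕ} (hn : 0 < n)
    (D : Fin n → ℝ × ℝ) {ν : Measure (NoisyCounts c)}
    (hν : ∀ k l : ℕ, 2 ≤ k → 2 ≤ l → ν.map (fun A => A k l) = noisyCountLaw L c ε D k l)
    {B δ : ℝ} (hB : 1 ≤ B) (hδ : 0 ≤ δ) (hδ1 : δ ≤ 1) :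
    ν {A | ∃ k l : ℕ, 2 ≤ k ∧ 2 ≤ l ∧ ((k * l : ℕ) : ℝ) ≤ B ∧ δ * n ≤ noiseDeviation L D A k l}
      ≤ ENNReal.ofReal (failureBound c ε B (n * δ ^ 2)) := by
  have hC := two_le_two_div_one_sub_exp hε
  refine (measure_mono ?_).trans (measure_gridSizes_biUnion_le _ hc hB (by linarith)
    (S := fun s => {A | δ * n ≤ noiseDeviation L D A s.1 s.2}) ?_)
  · rintro A ⟨k, l, hk, hl, hkl, h⟩
    exact mem_iUnion₂.2 ⟨(k, l), mem_gridSizes.2 ⟨hk, hl, hkl⟩, h⟩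
  · intro s hs
    obtain ⟨hk, hl, -⟩ := mem_gridSizes.1 hs
    have hmeas : Measurable fun A : NoisyCounts c => A s.1 s.2 :=
      (measurable_pi_apply s.2).comp (measurable_pi_apply s.1)
    have h := noisyCountLaw_sum_abs_sub_ge_le L c hε hn D s.1 s.2 (δ * n)
    rw [← hν _ _ hk hl, Measure.map_apply hmeas (Set.to_countable _).measurableSet] at h
    refine le_trans ?_ (h.trans (ENNReal.ofReal_le_ofReal
      (mul_le_mul_of_nonneg_left (Real.exp_le_exp.2 ?_) (by positivity))))
    · exact le_rfl
    · have h1 := mul_le_mul_of_nonneg_right (min_le_right (1 / 2) (ε / 4))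
        (show 0 ≤ n * δ ^ 2 by positivity)
      -- The noise tail is exponential in δn; `δ ≤ 1` weakens it to the δ²n form of the sampling
      -- tail.
      have h2 : n * δ ^ 2 ≤ δ * n := by
        have : (n : ℝ) * δ * δ ≤ n * δ * 1 := mul_le_mul_of_nonneg_left hδ1 (by positivity)
        linarith
      have h3 := mul_le_mul_of_nonneg_left h2 (show 0 ≤ ε / 4 by positivity)
      linarith

/-- On typical samples and noise, the output is close to `MIC*`. -/
theorem abs_micrGeomOutput_sub_lt (hc : 0 < c) {n : ℕ} (hn : 0 < n) {D : Fin n → ℝ × ℝ}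
    (hD : ∀ m, D m ∈ L.toSet) {B δ τ : ℝ} (hδ : 0 ≤ δ) (hB : 0 ≤ B)
    (hDμ : ∀ (k l : ℕ) (hk : 2 ≤ k) (hl : 2 ≤ l), ((k * l : ℕ) : ℝ) ≤ B →
      countDeviation μ L hc D hk hl ≤ δ * n) {A : NoisyCounts c}
    (hA : ∀ k l : ℕ, 2 ≤ k → 2 ≤ l → ((k * l : ℕ) : ℝ) ≤ B → noiseDeviation L D A k l ≤ δ * n)
    (hω : 3 * (3 * δ * (1 + Real.log n) + B / n) / Real.log 2 < τ / 2)
    (hlow : micStar μ < τ ∨ ∃ (k l : ℕ) (hk : 2 ≤ k) (hl : 2 ≤ l) (G : SubGrid c k l),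
      ((k * l : ℕ) : ℝ) ≤ B ∧ micStar μ - τ / 2 < normMutualInfo (pushMatrix G.1.1 G.2.1
        (masterLaw μ L (masterRows_pos hc (two_pos.trans_le hk) (two_pos.trans_le hl))
        (masterCols_pos hc (two_pos.trans_le hk) (two_pos.trans_le hl))))) :
    |micrGeomOutput B c A - micStar μ| < τ := by
  have hn1 : (1 : ℝ) ≤ n := by exact_mod_cast hn
  set ω := 3 * (3 * δ * (1 + Real.log n) + B / n) / Real.log 2 with hωdef
  have hω0 : 0 ≤ ω := by
    have := Real.log_nonneg hn1
    have := Real.log_pos (one_lt_two (α := ℝ))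
    positivity
  have hclose : ∀ (k l : ℕ) (hk : 2 ≤ k) (hl : 2 ≤ l), ((k * l : ℕ) : ℝ) ≤ B →
      ∀ G : SubGrid c k l, |normMutualInfo (pushMatrix G.1.1 G.2.1 (normalize (A k l)))
        - normMutualInfo (pushMatrix G.1.1 G.2.1 (masterLaw μ L
        (masterRows_pos hc (two_pos.trans_le hk) (two_pos.trans_le hl))
        (masterCols_pos hc (two_pos.trans_le hk) (two_pos.trans_le hl))))| ≤ ω :=
    fun k l hk hl hkl G => abs_normMutualInfo_normalize_sub_le _ _ hn hD hk hl hkl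
      (hA k l hk hl hkl) (hDμ k l hk hl hkl) _ _
  have hup : micrGeomOutput B c A ≤ micStar μ + ω :=
    micrGeomOutput_le hc hω0 fun k l hk hl hkl G => by
      linarith [(abs_le.1 (hclose k l hk hl hkl G)).2]
  rw [abs_lt]
  refine ⟨?_, by linarith⟩
  rcases hlow with h | ⟨k, l, hk, hl, G, hkl, h⟩
  · linarith [micrGeomOutput_nonneg B A]
  · linarith [(abs_le.1 (hclose k l hk hl hkl G)).1,
      normMutualInfo_le_micrGeomOutput A hk hl hkl G]

theorem isProbabilityMeasure_of_map_noisyCountLaw {ε : ℝ} (hε : 0 < ε) {n : ℕ} (hn : 0 < n)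
    (D : Fin n → ℝ × ℝ) {ν : Measure (NoisyCounts c)}
    (hν : ∀ k l : ℕ, 2 ≤ k → 2 ≤ l → ν.map (fun A => A k l) = noisyCountLaw L c ε D k l) :
    IsProbabilityMeasure ν := by
  have := isProbabilityMeasure_noisyCountLaw L c hε hn D 2 2
  rw [← hν 2 2 le_rfl le_rfl] at this
  exact Measure.isProbabilityMeasure_of_map fun A : NoisyCounts c => A 2 2

theorem tendsto_one_of_eventually_bounds {f : ℕ → ENNReal} {b : ℕ → ℝ} (hb : Tendsto b atTop (𝓝 0))
    (hlow : ∀ᶠ n in atTop, (1 - ENNReal.ofReal (b n)) * (1 - ENNReal.ofReal (b n)) ≤ f n)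
    (hup : ∀ᶠ n in atTop, f n ≤ 1) : Tendsto f atTop (𝓝 1) := by
  have h1 : Tendsto (fun n => 1 - ENNReal.ofReal (b n)) atTop (𝓝 1) := by
    have := ENNReal.Tendsto.sub (tendsto_const_nhds (x := (1 : ENNReal)) (f := atTop))
      (ENNReal.tendsto_ofReal hb) (Or.inl ENNReal.one_ne_top)
    simpa using this
  have h2 := ENNReal.Tendsto.mul h1 (Or.inl one_ne_zero) h1 (Or.inl one_ne_zero)
  rw [one_mul] at h2
  exact tendsto_of_tendsto_of_tendsto_of_le_of_le' h2 tendsto_const_nhds hlow hup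

/-- A lower bound for the lower integral of a function that need not be measurable. -/
theorem mul_le_lintegral_of_ae_notMem {Ω : Type*} [MeasurableSpace Ω] {P : Measure Ω}
    [IsProbabilityMeasure P] {f : Ω → ENNReal} {S : Set Ω} {a b : ENNReal} (hS : P S ≤ b)
    (hf : ∀ᵐ x ∂P, x ∉ S → a ≤ f x) : a * (1 - b) ≤ ∫⁻ x, f x ∂P := by
  -- Passing to a measurable hull of `S` keeps its measure and avoids any measurability assumption
  -- on `f`.
  have hm := (measurableSet_toMeasurable P S).compl
  calc a * (1 - b) ≤ a * P (toMeasurable P S)ᶜ := by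
        rw [prob_compl_eq_one_sub (measurableSet_toMeasurable P S), measure_toMeasurable]
        gcongr
    _ = ∫⁻ x, (toMeasurable P S)ᶜ.indicator (fun _ => a) x ∂P := (lintegral_indicator_const hm a).symm
    _ ≤ _ := by
        refine lintegral_mono_ae ?_
        filter_upwards [hf] with x hx
        by_cases h : x ∈ (toMeasurable P S)ᶜ
        · rw [indicator_of_mem h]
          exact hx fun h' => h (subset_toMeasurable P S h')
        · rw [indicator_of_notMem h]
          exact zero_le

end consistency

end MICr

end

theorem mainTheorem9 (L : MICr.Range) (c ε α : ℝ) (hc : 0 < c) (hε : 0 < ε)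
    (hα₀ : 0 < α) (hα₁ : α < 1 / 2) (B : ℕ → ℝ)
    (hB_top : Filter.Tendsto B Filter.atTop Filter.atTop)
    (hB_bigO : B =O[Filter.atTop] fun n : ℕ => (n : ℝ) ^ α)
    (T : ∀ n : ℕ, (Fin n → ℝ × ℝ) → MeasureTheory.Measure ℝ)
    (hT : ∀ n : ℕ, 0 < n → ∀ D : Fin n → ℝ × ℝ, (∀ m, D m ∈ L.toSet) →
      MICr.IsMICrGeom L (B n) c ε D (T n D)) :
    MICr.IsConsistentEstimator T MICr.micStar (MICr.boundedLaws L) := by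
  open MICr in
  rintro μ ⟨hprob, hμ⟩ τ hτ
  -- Small enough that δ log n → 0, large enough that nδ² = n^(1/2+α) dominates B².
  set δ : ℕ → ℝ := fun n => (n : ℝ) ^ (-(1 / 4 - α / 2)) with hδ
  have hδ0 : ∀ n, 0 ≤ δ n := fun n => Real.rpow_nonneg (Nat.cast_nonneg n) _
  have hδ1 : ∀ n, 0 < n → δ n ≤ 1 := fun n hn =>
    Real.rpow_le_one_of_one_le_of_nonpos (by exact_mod_cast hn) (by linarith)
  have hC := two_le_two_div_one_sub_exp hε
  have hb : Tendsto (fun n : ℕ => failureBound c ε (B n) (n * δ n ^ 2)) atTop (𝓝 0) :=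
    tendsto_exp_sq_sub_rate hα₀ hα₁ (lt_min (by norm_num) (by positivity))
      (add_nonneg (mul_nonneg (by linarith) (Real.log_nonneg (by linarith))) zero_le_two) hB_bigO
  have hlow : ∀ᶠ n in atTop, micStar μ < τ ∨ ∃ (k l : ℕ) (hk : 2 ≤ k) (hl : 2 ≤ l)
      (G : SubGrid c k l), ((k * l : ℕ) : ℝ) ≤ B n ∧
      micStar μ - τ / 2 < normMutualInfo (pushMatrix G.1.1 G.2.1
        (masterLaw μ L (masterRows_pos hc (two_pos.trans_le hk) (two_pos.trans_le hl))
        (masterCols_pos hc (two_pos.trans_le hk) (two_pos.trans_le hl)))) := by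
    -- When `MIC*` is below `τ`, nonnegativity of the output already gives the lower bound;
    -- otherwise the threshold `micStar μ - τ / 2` is nonnegative, as the approximation lemmas
    -- require.
    rcases lt_or_ge (micStar μ) τ with h | h
    · exact Eventually.of_forall fun _ => Or.inl h
    · obtain ⟨k, l, hk, hl, G, hG⟩ := exists_grid_of_lt_micStar μ
        (show 0 ≤ micStar μ - τ / 2 by linarith) (by linarith)
      obtain ⟨k', l', hk', hl', G', hG'⟩ := exists_subGrid_normMutualInfo_gt hμ hc hk hl G
        (by linarith) hG
      filter_upwards [hB_top.eventually_ge_atTop ((k' * l' : ℕ) : ℝ)] with n hn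
      exact Or.inr ⟨k', l', hk', hl', G', hn, hG'⟩
  have hmem : ∀ n : ℕ, ∀ᵐ D ∂(Measure.pi fun _ : Fin n => μ), ∀ m, D m ∈ L.toSet := fun n =>
    eventually_all.2 fun m => (Measure.quasiMeasurePreserving_eval (fun _ : Fin n => μ) m).ae
      (ae_mem_of_measure_toSet_eq_one hμ)
  refine tendsto_one_of_eventually_bounds hb ?_ ?_
  · filter_upwards [hlow, eventually_gt_atTop 0, hB_top.eventually_ge_atTop 1,
      (tendsto_error_rate hα₁ hB_bigO).eventually_lt_const (half_pos hτ)] with n hlow hn hB1 hω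
    -- One factor of the product bounds the probability of a typical sample, the other that of
    -- typical noise given such a sample.
    refine mul_le_lintegral_of_ae_notMem (measure_countDeviation_le (L := L) hc hε hn hB1 (hδ0 n)) ?_
    filter_upwards [hmem n] with D hD hgood
    obtain ⟨ν, hν, hρ⟩ := hT n hn D hD
    have hνp := isProbabilityMeasure_of_map_noisyCountLaw hε hn D hν
    have hDμ : ∀ (k l : ℕ) (hk : 2 ≤ k) (hl : 2 ≤ l), ((k * l : ℕ) : ℝ) ≤ B n →
        countDeviation μ L hc D hk hl ≤ δ n * n := fun k l hk hl hkl => by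
      by_contra! h
      exact hgood ⟨hD, k, l, hk, hl, hkl, h.le⟩
    rw [hρ, Measure.map_apply (measurable_micrGeomOutput _ _)
      (measurableSet_lt (by fun_prop) measurable_const), tsub_le_iff_left]
    calc (1 : ENNReal) = ν univ := measure_univ.symm
      _ ≤ ν ({A | ∃ k l : ℕ, 2 ≤ k ∧ 2 ≤ l ∧ ((k * l : ℕ) : ℝ) ≤ B n ∧
            δ n * n ≤ noiseDeviation L D A k l}
          ∪ micrGeomOutput (B n) c ⁻¹' {v | |v - micStar μ| < τ}) := by
          refine measure_mono fun A _ => or_iff_not_imp_left.2 fun hA => ?_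
          refine abs_micrGeomOutput_sub_lt hc hn hD (hδ0 n) (zero_le_one.trans hB1) hDμ
            (fun k l hk hl hkl => ?_) hω hlow
          by_contra! h
          exact hA ⟨k, l, hk, hl, hkl, h.le⟩
      _ ≤ _ := (measure_union_le _ _).trans (add_le_add_left
          (measure_noiseDeviation_le hc hε hn D hν hB1 (hδ0 n) (hδ1 n hn)) _)
  · filter_upwards [eventually_gt_atTop 0] with n hn
    calc ∫⁻ D, T n D {v | |v - micStar μ| < τ} ∂(Measure.pi fun _ : Fin n => μ)
        ≤ ∫⁻ _, 1 ∂(Measure.pi fun _ : Fin n => μ) := by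
          refine lintegral_mono_ae ?_
          filter_upwards [hmem n] with D hD
          obtain ⟨ν, hν, hρ⟩ := hT n hn D hD
          have hνp := isProbabilityMeasure_of_map_noisyCountLaw hε hn D hν
          have := Measure.isProbabilityMeasure_map (μ := ν)
            (measurable_micrGeomOutput (B n) c).aemeasurable
          rw [hρ]
          exact prob_le_one
      _ = 1 := by simp
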